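/- **Conventions.** Let $k$ be a number field with ring of integers $\mathfrak o$ and let $\mathcal V_k$ be its set of non-Archimedean places. For $v\in\mathcal V_k$ let $\mathfrak o_v$ be the valuation ring of the completion $k_v$; for $S\subset\mathcal V_k$ let $\mathfrak o_S=\{x\in k: |x|_v\le 1\text{ for all }v\in\mathcal V_k\setminus S\}$. For a commutative ring $R$ and $A\in\mathrm{Mat}_n(R)$, let $a_m(A,R)$ be the number of $R$-submodules $U\le R^n$ of additive index $m$ with $UA\subset U$ (matrices act on row vectors from the right), and let $\zeta_{A,R}(s)=\sum_{m\ge1}a_m(A,R)\,m^{-s}$. For a monic polynomial $g=X^d+a_{d-1}X^{d-1}+\dots+a_0$ let $\mathsf C(g)$ be its companion matrix (ones on the superdiagonal, last row $(-a_0,\dots,-a_{d-1})$, zeros elsewhere). For a partition $\lambda=(\lambda_1\ge\dots\ge\lambda_r>0)$ put $\mathsf N(\lambda)=\mathrm{diag}(\mathsf C(X^{\lambda_1}),\dots,\mathsf C(X^{\lambda_r}))$. For $f\in k[X]$ monic and irreducible, a matrix $A\in\mathrm{Mat}_n(k)$ is *$f$-primary of type $\lambda$* if its minimal polynomial is a power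 of $f$ and $A$ is similar over $k$ to $\mathrm{diag}(\mathsf C(f^{\lambda_1}),\dots,\mathsf C(f^{\lambda_r}))$; then $\lambda$ is a partition of $n/\deg f$. **Theorem 3.1.** Let $f\in k[X]$ be monic and irreducible, let $n\ge1$, and let $A\in\mathrm{Mat}_n(k)$ be $f$-primary of type $\lambda$. Let $k'=k[X]/(f)$, with ring of integers $\mathfrak o'$. Then for all but finitely many $v\in\mathcal V_k$, $A$ has entries in $\mathfrak o_v$ and $$\zeta_{A,\mathfrak o_v}(s)=\prod_{\substack{w\in\mathcal V_{k'}\\ w\mid v}}\zeta_{\mathsf N(\lambda),\mathfrak o'_w}(s).$$ Hence there is a finite set $S_0\subset\mathcal V_k$ such that for every finite $S\subset\mathcal V_k$ with $S\supset S_0$, $A$ has entries in $\mathfrak o_S$ and, with $S'=\{w\in\mathcal V_{k'}: w\mid v\text{ for some }v\in S\}$, $$\zeta_{A,\mathfrak o_S}(s)=\zeta_{\mathsf N(\lambda),\mathfrak o'_{S'}}(s).$$ Here all the numbers $a_m$ involved are finite, each of the zeta functions converges absolutely in some right half-plane, and the equalities hold both coefficientwise, as formal Dirichlet series, and as functions of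 $s$ to the right of the abscissa of convergence of the left-hand side, where the series on the right-hand side converge too. -/

import Mathlib

open IsDedekindDomain NumberField Polynomial
open scoped ArithmeticFunction

noncomputable section

namespace InvariantZeta

/-! ### Matrices -/

section Matrices

variable {R : Type*} [CommRing R]

/-- The companion matrix `C(f)` of a monic polynomial `f` of degree `d`: ones on the
superdiagonal, last row `(-a_0, …, -a_{d-1})`, and zeros elsewhere. -/
def companion (d : ℕ) (f : R[X]) : Matrix (Fin d) (Fin d) R :=
  Matrix.of fun i j =>
    if (i : ℕ) + 1 = d then -f.coeff j else if (i : ℕ) + 1 = j then 1 else 0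

/-- The parts `λ_1 ≥ λ_2 ≥ … ≥ λ_r` of a partition, as a non-increasing list. -/
def partList {m : ℕ} (l : m.Partition) : List ℕ := l.parts.sort (· ≥ ·)

variable (R) in
/-- The nilpotent matrix `N(λ) = diag(C(X^{λ_1}), …, C(X^{λ_r}))` over `R`. -/
def nilMatrix {m : ℕ} (l : m.Partition) :
    Matrix (Σ i : Fin (partList l).length, Fin ((partList l).get i))
      (Σ i : Fin (partList l).length, Fin ((partList l).get i)) R :=
  Matrix.blockDiagonal' fun i => companion ((partList l).get i) (X ^ (partList l).get i)

/-- The primary rational canonical form `diag(C(f^{λ_1}), …, C(f^{λ_r}))`. -/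
def primaryForm (f : R[X]) {m : ℕ} (l : m.Partition) :
    Matrix (Σ i : Fin (partList l).length, Fin (f ^ (partList l).get i).natDegree)
      (Σ i : Fin (partList l).length, Fin (f ^ (partList l).get i).natDegree) R :=
  Matrix.blockDiagonal' fun i =>
    companion (f ^ (partList l).get i).natDegree (f ^ (partList l).get i)

/-- Similarity of square matrices over `R`; the index sets are allowed to be different (in
bijection) finite types. -/
def Similar {ι κ : Type*} [Fintype ι] [DecidableEq ι] [Fintype κ] [DecidableEq κ]
    (A : Matrix ι ι R) (B : Matrix κ κ R) : Prop :=
  ∃ (P : Matrix ι κ R) (Q : Matrix κ ι R), P * Q = 1 ∧ Q * P = 1 ∧ A = P * B * Q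

/-- `A` is `f`-primary of type `λ`: its minimal polynomial is a power of `f`, and its elementary
divisors are `f^{λ_1}, …, f^{λ_r}`. -/
def IsPrimaryOfType {k : Type*} [Field k] {n m : ℕ} (f : k[X]) (A : Matrix (Fin n) (Fin n) k)
    (l : m.Partition) : Prop :=
  (∃ e : ℕ, minpoly k A = f ^ e) ∧ Similar A (primaryForm f l)

end Matrices

/-! ### Zeta functions -/

section Zeta

variable {R : Type*} [CommRing R] {ι : Type*} [Fintype ι]

/-- The `A`-invariant `R`-submodules `U` of `R^ι` of additive index `m`; matrices act by right
multiplication on row vectors. -/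
def invariantSubmodules (A : Matrix ι ι R) (m : ℕ) : Set (Submodule R (ι → R)) :=
  {U | (∀ x ∈ U, Matrix.vecMul x A ∈ U) ∧ U.toAddSubgroup.index = m}

/-- The coefficients `a_m(A, R)`, `m ≥ 1`, as an arithmetic function, i.e. as a formal Dirichlet
series; multiplication of arithmetic functions is multiplication of Dirichlet series. (The value
at `0` is `0` by convention: `AddSubgroup.index` is `0` for subgroups of infinite index, which are
not counted.) -/
def coeffs (A : Matrix ι ι R) : ArithmeticFunction ℕ where
  toFun m := if m = 0 then 0 else (invariantSubmodules A m).ncard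
  map_zero' := if_pos rfl

/-- The abscissa of (absolute) convergence of the Dirichlet series `ζ_{A,R}`. -/
def abscissa (A : Matrix ι ι R) : EReal :=
  LSeries.abscissaOfAbsConv fun m => (coeffs A m : ℂ)

/-- The zeta function `ζ_{A,R}(s) = ∑_{m ≥ 1} a_m(A, R) m^{-s}`. -/
def zeta (A : Matrix ι ι R) (s : ℂ) : ℂ :=
  LSeries (fun m => (coeffs A m : ℂ)) s

/-- The zeta function of `A` over `R` is well defined: all the numbers `a_m(A, R)` are finite, and
the Dirichlet series converges in some half-plane. -/
def HasZeta (A : Matrix ι ι R) : Prop :=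
  (∀ m : ℕ, m ≠ 0 → (invariantSubmodules A m).Finite) ∧ abscissa A < ⊤

end Zeta

/-! ### Number fields -/

section NumberFields

/-- `k[X]/(f)` is a number field. -/
instance numberFieldAdjoinRoot {k : Type*} [Field k] [NumberField k] (f : k[X])
    [Fact (Irreducible f)] : NumberField (AdjoinRoot f) := by
  have hf : f ≠ 0 := (Fact.out : Irreducible f).ne_zero
  have : Module.Finite k (AdjoinRoot f) := (AdjoinRoot.powerBasis hf).finite
  exact NumberField.of_module_finite k (AdjoinRoot f)

/-- For an extension `k'/k` of number fields: the set of places of `k'` that divide some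
`v ∈ S`. -/
def placesAbove (k k' : Type*) [Field k] [Field k'] [Algebra k k']
    (S : Set (HeightOneSpectrum (𝓞 k))) : Set (HeightOneSpectrum (𝓞 k')) :=
  {w | ∃ v ∈ S, w.asIdeal.LiesOver v.asIdeal}

end NumberFields

end InvariantZeta

end

/-! Right multiplication by A makes the row space k^n a k[X]-module, isomorphic to Z = ∏
k[X]/(f^{λ_i}), with A acting as X. In characteristic zero f is separable, so Newton iteration lifts
a root of f to k[X]/(f^m) (`exists_aeval_eq_zero_adjoinRoot_pow`). This embeds k' = k[X]/(f) as a
coefficient field, over which each k[X]/(f^e) consists of truncated power series in f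
(`truncatedSeries_bijective`). Multiplication by f on such series is the nilpotent block C(X^e).
Thus A and N(λ) are multiplications by elements x and y of one algebra Z, and k[x] = σ(k')[y], where
σ embeds k' in Z (`exists_common_algebra`).

Only finitely many coefficients enter into these identities and into the comparison of the two
standard lattices in Z. Once the finite set S contains the places in their denominators, the
lattices agree and the 𝔬_S-submodules stable under x are the 𝔬'_{S'}-submodules stable under y
(`eventually_stable_iff`, `eventually_lattice_iff`, `eventually_exists_equiv`). This is the global
equality.

The local one follows from a single such S. For v outside S, finite-index invariant submodules over
𝔬_v correspond to the v-primary ones over 𝔬_S (`coeffs_map_eq_primaryCoeffs`), hence to submodules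
over 𝔬'_{S'} that are primary for the places above v. By the Chinese remainder theorem these split
into w-primary components, with multiplicative indices (`primaryCoeffs_eq_prod`), and each factor is
again a count over a completion. Convergence comes from a polynomial bound on the number of
subgroups of index m (`finite_and_ncard_addSubgroup_index_le`). -/

noncomputable section

set_option linter.unusedSectionVars false

namespace InvariantZeta

/-! ### Ideals supported at a set of primes. -/

section Supported

variable {D : Type*} [CommRing D] [IsDedekindDomain D]

/-- The ideals that are products of primes in `T`. -/
def supportedIdeals (T : Set (HeightOneSpectrum D)) : Submonoid (Ideal D) :=
  Submonoid.closure (HeightOneSpectrum.asIdeal '' T)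

lemma mem_of_mem_supportedIdeals {T : Set (HeightOneSpectrum D)} {J : Ideal D}
    (hJ : J ∈ supportedIdeals T) {p : HeightOneSpectrum D} (hp : J ≤ p.asIdeal) : p ∈ T := by
  induction hJ using Submonoid.closure_induction with
  | mem x hx =>
    obtain ⟨w, hw, rfl⟩ := hx
    have := w.isMaximal.eq_of_le p.isPrime.ne_top hp
    rwa [← HeightOneSpectrum.ext this]
  | one => exact absurd (top_le_iff.mp (Ideal.one_eq_top (R := D) ▸ hp)) p.isPrime.ne_top
  | mul x y _ _ hx hy => exact (p.isPrime.mul_le.mp hp).elim hx hy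

lemma isCoprime_of_mem_supportedIdeals {T T' : Set (HeightOneSpectrum D)} (hT : Disjoint T T')
    {J J' : Ideal D} (hJ : J ∈ supportedIdeals T) (hJ' : J' ∈ supportedIdeals T') :
    IsCoprime J J' := by
  induction hJ using Submonoid.closure_induction with
  | one => exact isCoprime_one_left
  | mul x y _ _ hx hy => exact hx.mul_left hy
  | mem x hx =>
    obtain ⟨w, hw, rfl⟩ := hx
    rw [Ideal.isCoprime_iff_sup_eq]
    by_contra h
    have h1 : w.asIdeal ⊔ J' = w.asIdeal := (w.isMaximal.eq_of_le h le_sup_left).symm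
    exact Set.disjoint_left.mp hT hw
      (mem_of_mem_supportedIdeals hJ' (sup_eq_left.mp h1))

lemma supportedIdeals_ne_bot {T : Set (HeightOneSpectrum D)} {J : Ideal D}
    (hJ : J ∈ supportedIdeals T) : J ≠ ⊥ := by
  induction hJ using Submonoid.closure_induction with
  | one => simp
  | mul x y _ _ hx hy => exact mul_ne_zero hx hy
  | mem x hx =>
    obtain ⟨w, hw, rfl⟩ := hx
    exact w.ne_bot

lemma mem_supportedIdeals {T : Set (HeightOneSpectrum D)} {J : Ideal D} (hJ : J ≠ ⊥)
    (hT : ∀ p : HeightOneSpectrum D, J ≤ p.asIdeal → p ∈ T) : J ∈ supportedIdeals T := by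
  rw [← Ideal.prod_normalizedFactors_eq_self hJ]
  refine Submonoid.multiset_prod_mem _ _ fun P hP => Submonoid.subset_closure ?_
  have hP' := UniqueFactorizationMonoid.prime_of_normalized_factor P hP
  let p : HeightOneSpectrum D := ⟨P, Ideal.isPrime_of_prime hP', hP'.ne_zero⟩
  exact ⟨p, hT p (Ideal.le_of_dvd (UniqueFactorizationMonoid.dvd_of_mem_normalizedFactors hP)), rfl⟩

lemma exists_mul_of_mem_supportedIdeals_union {T T' : Set (HeightOneSpectrum D)} {J : Ideal D}
    (hJ : J ∈ supportedIdeals (T ∪ T')) :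
    ∃ I ∈ supportedIdeals T, ∃ I' ∈ supportedIdeals T', I * I' = J := by
  rw [supportedIdeals, Set.image_union, Submonoid.closure_union, Submonoid.mem_sup] at hJ
  exact hJ

lemma supportedIdeals_mono {T T' : Set (HeightOneSpectrum D)} (h : T ⊆ T') :
    supportedIdeals T ≤ supportedIdeals T' :=
  Submonoid.closure_mono (Set.image_mono h)

lemma mem_supportedIdeals_singleton {w : HeightOneSpectrum D} {J : Ideal D} :
    J ∈ supportedIdeals {w} ↔ ∃ N : ℕ, w.asIdeal ^ N = J := by
  rw [supportedIdeals, Set.image_singleton, Submonoid.mem_closure_singleton]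

end Supported

/-! ### Clearing denominators at the places in S. -/

section Relative

variable {k k' : Type*} [Field k] [NumberField k] [Field k'] [NumberField k'] [Algebra k k']

lemma placesAbove_self (S : Set (HeightOneSpectrum (𝓞 k))) : placesAbove k k S = S := by
  ext w
  constructor
  · rintro ⟨v, hv, h⟩
    have : v = w := HeightOneSpectrum.ext h.over
    rwa [← this]
  · exact fun hw => ⟨w, hw, ⟨rfl⟩⟩

lemma mem_placesAbove_iff {S : Set (HeightOneSpectrum (𝓞 k))} {w : HeightOneSpectrum (𝓞 k')} :
    w ∈ placesAbove k k' S ↔ w.under (𝓞 k) ∈ S := by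
  constructor
  · rintro ⟨v, hv, h⟩
    have : v = w.under (𝓞 k) := HeightOneSpectrum.ext h.over
    rwa [← this]
  · exact fun hw => ⟨_, hw, ⟨rfl⟩⟩

lemma algebraMap_mem_iff_mem_under (w : HeightOneSpectrum (𝓞 k')) (a : 𝓞 k) :
    algebraMap (𝓞 k) (𝓞 k') a ∈ w.asIdeal ↔ a ∈ (w.under (𝓞 k)).asIdeal := Iff.rfl

/-- An element of `k'` that is integral away from the places above `S` becomes integral after
multiplication with an integer of `k` whose prime factors are all in `S`. -/
lemma exists_mul_eq_algebraMap (S : Set (HeightOneSpectrum (𝓞 k))) {x : k'}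
    (hx : x ∈ (placesAbove k k' S).integer k') :
    ∃ c : 𝓞 k, c ≠ 0 ∧ (∀ v ∉ S, c ∉ v.asIdeal) ∧ ∃ y : 𝓞 k',
      algebraMap (𝓞 k') k' (algebraMap (𝓞 k) (𝓞 k') c) * x = algebraMap (𝓞 k') k' y := by
  obtain ⟨b, hb, a, hab⟩ : ∃ b : 𝓞 k, b ≠ 0 ∧ ∃ a : 𝓞 k',
      algebraMap (𝓞 k') k' (algebraMap (𝓞 k) (𝓞 k') b) * x = algebraMap (𝓞 k') k' a := by
    obtain ⟨a₀, b₀, hb₀, rfl⟩ := IsFractionRing.div_surjective (A := 𝓞 k') x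
    have hb₀ := nonZeroDivisors.ne_zero hb₀
    -- By integrality of 𝓞 k' over 𝓞 k, the ideal (b₀) contracts to a nonzero ideal, so a
    -- denominator can be found in 𝓞 k.
    obtain ⟨b, hb, hbne⟩ := Submodule.exists_mem_ne_zero_of_ne_bot
      (Ideal.IsIntegral.comap_ne_bot (R := 𝓞 k) (A := 𝓞 k')
        (I := Ideal.span {b₀}) (by simpa using hb₀))
    obtain ⟨t, ht⟩ := Ideal.mem_span_singleton'.mp (Ideal.mem_comap.mp hb)
    refine ⟨b, hbne, t * a₀, ?_⟩
    have : algebraMap (𝓞 k') k' b₀ ≠ 0 := by simpa using hb₀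
    rw [← ht, map_mul, map_mul]
    field_simp
  -- The denominator b may have prime factors outside S. Split (b) = I I' into its S-part and the
  -- rest; with h the class number, I^h = (c) is principal, and c has prime factors in S only.
  have hJ : Ideal.span {b} ∈ supportedIdeals (S ∪ Sᶜ) :=
    mem_supportedIdeals (by simpa using hb) fun p _ => by simp
  obtain ⟨I, hI, I', hI', hII⟩ := exists_mul_of_mem_supportedIdeals_union hJ
  have hI0 : I ∈ nonZeroDivisors (Ideal (𝓞 k)) :=
    mem_nonZeroDivisors_of_ne_zero (supportedIdeals_ne_bot hI)
  set h := Fintype.card (ClassGroup (𝓞 k)) with hh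
  have hh0 : h ≠ 0 := Fintype.card_ne_zero
  have hprin : Submodule.IsPrincipal (I ^ h) := by
    rw [← ClassGroup.mk0_eq_one_iff (pow_mem hI0 h)]
    have : (⟨I ^ h, pow_mem hI0 h⟩ : nonZeroDivisors (Ideal (𝓞 k))) = ⟨I, hI0⟩ ^ h := rfl
    rw [this, map_pow, pow_card_eq_one]
  obtain ⟨c, hc⟩ := hprin
  have hc : I ^ h = Ideal.span {c} := hc
  have hcI : c ∈ I ^ h := hc ▸ Ideal.mem_span_singleton_self c
  have hcS : ∀ v ∉ S, c ∉ v.asIdeal := fun v hv hcv =>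
    hv (mem_of_mem_supportedIdeals (pow_mem hI h) (hc ▸ (Ideal.span_singleton_le_iff_mem _).mpr hcv))
  refine ⟨c, ?_, hcS, ?_⟩
  · rintro rfl
    exact supportedIdeals_ne_bot (pow_mem hI h) (by simpa using hc)
  suffices H : ∀ w : HeightOneSpectrum (𝓞 k'), w.valuation k'
      (algebraMap (𝓞 k') k' (algebraMap (𝓞 k) (𝓞 k') c) * x) ≤ 1 by
    obtain ⟨y, hy⟩ := HeightOneSpectrum.mem_integers_of_valuation_le_one k' _ H
    exact ⟨y, hy.symm⟩
  intro w
  by_cases hw : w ∈ placesAbove k k' S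
  · rw [mem_placesAbove_iff] at hw
    -- I' has no prime factor in S, so some d in I' is a unit at w. As cd lies in I I' = (b), the
    -- product c d x is integral, and hence c x is integral at w.
    obtain ⟨d, hdI, hd⟩ : ∃ d ∈ I', d ∉ (w.under (𝓞 k)).asIdeal := by
      by_contra! hcon
      exact mem_of_mem_supportedIdeals hI' (p := w.under (𝓞 k)) hcon hw
    have hcd : c * d ∈ Ideal.span {b} := hII ▸ Ideal.mul_mem_mul (Ideal.pow_le_self hh0 hcI) hdI
    obtain ⟨t, ht⟩ := Ideal.mem_span_singleton'.mp hcd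
    have hvd : w.valuation k' (algebraMap (𝓞 k') k' (algebraMap (𝓞 k) (𝓞 k') d)) = 1 :=
      (HeightOneSpectrum.valuation_eq_one_iff_notMem _).mpr
        (by rwa [algebraMap_mem_iff_mem_under])
    have key : algebraMap (𝓞 k') k' (algebraMap (𝓞 k) (𝓞 k') c) * x *
        algebraMap (𝓞 k') k' (algebraMap (𝓞 k) (𝓞 k') d) =
        algebraMap (𝓞 k') k' (algebraMap (𝓞 k) (𝓞 k') t * a) := by
      rw [mul_right_comm, ← map_mul, ← map_mul, ← ht, map_mul, map_mul, map_mul, ← hab]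
      ring
    have := congrArg (w.valuation k') key
    rw [map_mul _ _ (algebraMap (𝓞 k') k' (algebraMap (𝓞 k) (𝓞 k') d)), hvd, mul_one] at this
    rw [this]
    exact w.valuation_le_one _
  · rw [map_mul]
    exact mul_le_one' (w.valuation_le_one _) (hx w hw)

end Relative

/-! ### Polynomial bounds for the number of submodules of given index. -/

section Counting

/-- A basis has at most |σ| elements and is padded with zeros, so that the generators of every
subgroup have the same index type. -/
lemma exists_span_range_eq {σ : Type*} [Fintype σ] (H : Submodule ℤ (σ → ℤ)) :
    ∃ h : σ → σ → ℤ, Submodule.span ℤ (Set.range h) = H := by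
  classical
  obtain ⟨n, ⟨b⟩⟩ := Submodule.nonempty_basis_of_pid (Pi.basisFun ℤ σ) H
  have hn : n ≤ Fintype.card σ := by
    have := Submodule.finrank_le H
    rwa [Module.finrank_eq_card_basis b, Fintype.card_fin, Module.finrank_fintype_fun_eq_card]
      at this
  let e := Fintype.equivFin σ
  refine ⟨fun i => if hi : (e i : ℕ) < n then b ⟨e i, hi⟩ else 0, le_antisymm ?_ ?_⟩
  · rw [Submodule.span_le]
    rintro _ ⟨i, rfl⟩
    dsimp only
    split_ifs with hi
    · exact (b _).2
    · exact H.zero_mem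
  · intro x hx
    have h1 : (⟨x, hx⟩ : H) ∈ Submodule.span ℤ (Set.range b) := by simp
    have h2 := Submodule.mem_map_of_mem (f := H.subtype) h1
    rw [Submodule.map_span, ← Set.range_comp] at h2
    refine Submodule.span_mono ?_ h2
    rintro _ ⟨j, rfl⟩
    refine ⟨e.symm ⟨j, j.2.trans_le hn⟩, ?_⟩
    simp

/-- If `G` is generated modulo `m` by `s` elements, then it has at most `m ^ (s * s)` subgroups of
index `m`. -/
lemma finite_and_ncard_addSubgroup_index_le {G σ : Type*} [AddCommGroup G] [Fintype σ] {m : ℕ}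
    (hm : m ≠ 0) (g : σ → G) (hg : ∀ x, ∃ z : σ → ℤ, ∃ y, x = ∑ i, z i • g i + m • y) :
    {U : AddSubgroup G | U.index = m}.Finite ∧
      {U : AddSubgroup G | U.index = m}.ncard ≤ m ^ (Fintype.card σ * Fintype.card σ) := by
  classical
  -- A subgroup of index m contains mG, so it is determined by the lattice of those z in ℤ^σ with ∑
  -- z_i g_i in it, and generators of this lattice matter only modulo m; c is their matrix of
  -- residues.
  let F : (σ → σ → Fin m) → AddSubgroup G := fun c =>
    AddSubgroup.closure (Set.range (fun i => ∑ j, ((c i j : ℕ) : ℤ) • g j)) ⊔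
      (nsmulAddMonoidHom m).range
  have hmem : ∀ (V : AddSubgroup G) (z : σ → ℤ),
      z ∈ (AddSubgroup.toIntSubmodule V).comap (Fintype.linearCombination ℤ g) ↔
        ∑ i, z i • g i ∈ V := fun V z => by
    rw [Submodule.mem_comap, Fintype.linearCombination_apply]
    exact Iff.rfl
  have hcl : ∀ c i, ∑ j, ((c i j : ℕ) : ℤ) • g j ∈ F c := fun c i =>
    AddSubgroup.mem_sup_left (AddSubgroup.subset_closure ⟨i, rfl⟩)
  have hmF : ∀ c y, m • y ∈ F c := fun c y => AddSubgroup.mem_sup_right ⟨y, rfl⟩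
  have hFle : ∀ (c : σ → σ → Fin m) (U : AddSubgroup G),
      (∀ i, ∑ j, ((c i j : ℕ) : ℤ) • g j ∈ U) → (∀ y, m • y ∈ U) → F c ≤ U := fun c U h1 h2 =>
    sup_le ((AddSubgroup.closure_le _).mpr (by rintro _ ⟨i, rfl⟩; exact h1 i))
      (by rintro _ ⟨y, rfl⟩; exact h2 y)
  clear_value F
  have hsub : {U : AddSubgroup G | U.index = m} ⊆ Set.range F := by
    rintro U (hU : U.index = m)
    have hmU : ∀ y, m • y ∈ U := fun y => hU ▸ U.nsmul_index_mem y
    obtain ⟨h, hh⟩ := exists_span_range_eq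
      ((AddSubgroup.toIntSubmodule U).comap (Fintype.linearCombination ℤ g))
    have hhU : ∀ i, ∑ j, h i j • g j ∈ U := fun i => by
      have : h i ∈ Submodule.span ℤ (Set.range h) := Submodule.subset_span ⟨i, rfl⟩
      rwa [hh, hmem] at this
    have hm0 : (m : ℤ) ≠ 0 := by exact_mod_cast hm
    let c : σ → σ → Fin m := fun i j =>
      ⟨(h i j % m).toNat, by
        have := Int.emod_lt_of_pos (h i j) (by positivity : (0 : ℤ) < m)
        have := Int.emod_nonneg (h i j) hm0
        omega⟩
    have hc : ∀ i, ∑ j, h i j • g j = ∑ j, ((c i j : ℕ) : ℤ) • g j +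
        m • ∑ j, (h i j / m) • g j := fun i => by
      rw [Finset.smul_sum, ← Finset.sum_add_distrib]
      refine Finset.sum_congr rfl fun j _ => ?_
      have : ((c i j : ℕ) : ℤ) = h i j % m := Int.toNat_of_nonneg (Int.emod_nonneg _ hm0)
      rw [this, ← natCast_zsmul, smul_smul, ← add_smul, Int.emod_add_mul_ediv]
    refine ⟨c, le_antisymm (hFle c U (fun i => ?_) hmU) ?_⟩
    · have := U.sub_mem (hhU i) (hmU (∑ j, (h i j / m) • g j))
      rwa [hc i, add_sub_cancel_right] at this
    · intro x hx
      obtain ⟨z, y, rfl⟩ := hg x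
      refine (F c).add_mem ?_ (hmF c y)
      have hz : z ∈ Submodule.span ℤ (Set.range h) := by
        rw [hh]
        have := U.sub_mem hx (hmU y)
        rwa [add_sub_cancel_right, ← hmem] at this
      have hle : Submodule.span ℤ (Set.range h) ≤
          (AddSubgroup.toIntSubmodule (F c)).comap (Fintype.linearCombination ℤ g) := by
        rw [Submodule.span_le]
        rintro _ ⟨i, rfl⟩
        rw [SetLike.mem_coe, hmem, hc i]
        exact (F c).add_mem (hcl c i) (hmF c _)
      exact (hmem _ _).mp (hle hz)
  refine ⟨(Set.finite_range F).subset hsub, ?_⟩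
  calc _ ≤ (Set.range F).ncard := Set.ncard_le_ncard hsub (Set.finite_range F)
    _ ≤ Nat.card (σ → σ → Fin m) := by
        rw [← Set.image_univ, ← Set.ncard_univ]
        exact Set.ncard_image_le Set.finite_univ
    _ = _ := by simp [pow_mul]

lemma finite_and_ncard_invariantSubmodules_le {R ι σ : Type*} [CommRing R] [Fintype ι] [Fintype σ]
    (A : Matrix ι ι R) {m : ℕ} (hm : m ≠ 0) (g : σ → R)
    (hg : ∀ x, ∃ z : σ → ℤ, ∃ y, x = ∑ i, z i • g i + m • y) :
    (invariantSubmodules A m).Finite ∧ (invariantSubmodules A m).ncard ≤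
      m ^ (Fintype.card (ι × σ) * Fintype.card (ι × σ)) := by
  classical
  obtain ⟨hf, hc⟩ := finite_and_ncard_addSubgroup_index_le (G := ι → R) hm
    (fun p : ι × σ => Pi.single p.1 (g p.2)) (fun x => by
      choose z y hzy using fun i => hg (x i)
      refine ⟨fun p => z p.1 p.2, y, ?_⟩
      ext i
      rw [hzy i]
      simp [Fintype.sum_prod_type, Finset.sum_apply, Pi.single_apply, Finset.sum_comm (s := (Finset.univ : Finset ι))])
  have hinj : Function.Injective (Submodule.toAddSubgroup : Submodule R (ι → R) → _) :=
    Submodule.toAddSubgroup_injective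
  have hmaps : ∀ U ∈ invariantSubmodules A m,
      U.toAddSubgroup ∈ {U : AddSubgroup (ι → R) | U.index = m} := fun U hU => hU.2
  exact ⟨Set.Finite.of_injOn hmaps hinj.injOn hf,
    (Set.ncard_le_ncard_of_injOn _ hmaps hinj.injOn hf).trans hc⟩

/-- An integral basis of K generates R modulo every m, with a number of generators independent of m.
So a_m ≤ m^s for a fixed s, and the abscissa is at most s + 1. -/
lemma hasZeta_of_forall_exists {K R ι : Type*} [Field K] [NumberField K] [CommRing R] [Fintype ι]
    (φ : 𝓞 K →+ R) (hφ : ∀ m : ℕ, m ≠ 0 → ∀ x : R, ∃ a y, x = φ a + m • y)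
    (A : Matrix ι ι R) : HasZeta A := by
  classical
  have key := fun m (hm : m ≠ 0) => finite_and_ncard_invariantSubmodules_le A hm
    (fun i => φ (RingOfIntegers.basis K i)) (fun x => by
      obtain ⟨a, y, rfl⟩ := hφ m hm x
      refine ⟨fun i => (RingOfIntegers.basis K).repr a i, y, ?_⟩
      congr 1
      conv_lhs => rw [← (RingOfIntegers.basis K).sum_repr a]
      rw [map_sum]
      exact Finset.sum_congr rfl fun i _ => map_zsmul φ _ _)
  refine ⟨fun m hm => (key m hm).1, ?_⟩
  set s := Fintype.card (ι × Module.Free.ChooseBasisIndex ℤ (𝓞 K)) *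
    Fintype.card (ι × Module.Free.ChooseBasisIndex ℤ (𝓞 K))
  refine lt_of_le_of_lt (LSeries.abscissaOfAbsConv_le_of_le_const_mul_rpow (x := s)
    ⟨1, fun m hm => ?_⟩) (EReal.coe_lt_top ((s : ℝ) + 1))
  have h1 : coeffs A m = (invariantSubmodules A m).ncard := if_neg hm
  rw [h1, one_mul, Real.rpow_natCast]
  simpa using (by exact_mod_cast (key m hm).2 :
    ((invariantSubmodules A m).ncard : ℝ) ≤ (m : ℝ) ^ s)

end Counting

/-! ### Primary decomposition of invariant submodules. -/

section PrimarySubmodules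

variable {D R ι : Type*} [CommRing D] [IsDedekindDomain D] [CommRing R] [Algebra D R] [Fintype ι]

variable (R ι) in
/-- The submodules of `R^ι` that contain `J R^ι` for some product `J` of primes in `T`. -/
def primarySubmodules (T : Set (HeightOneSpectrum D)) : Set (Submodule R (ι → R)) :=
  {U | ∃ J ∈ supportedIdeals T, ∀ a ∈ J, ∀ x : ι → R, a • x ∈ U}

/-- The Dirichlet series counting the `A`-invariant submodules in `primarySubmodules R ι T`. -/
def primaryCoeffs (T : Set (HeightOneSpectrum D)) (A : Matrix ι ι R) : ArithmeticFunction ℕ where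
  toFun m := if m = 0 then 0 else (invariantSubmodules A m ∩ primarySubmodules R ι T).ncard
  map_zero' := if_pos rfl

lemma primaryCoeffs_apply (T : Set (HeightOneSpectrum D)) (A : Matrix ι ι R) {m : ℕ}
    (hm : m ≠ 0) :
    primaryCoeffs T A m = (invariantSubmodules A m ∩ primarySubmodules R ι T).ncard :=
  if_neg hm

lemma coeffs_apply (A : Matrix ι ι R) {m : ℕ} (hm : m ≠ 0) :
    coeffs A m = (invariantSubmodules A m).ncard :=
  if_neg hm

lemma primarySubmodules_mono {T T' : Set (HeightOneSpectrum D)} (h : T ⊆ T') :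
    primarySubmodules R ι T ⊆ primarySubmodules R ι T' :=
  fun _ ⟨J, hJ, hU⟩ => ⟨J, supportedIdeals_mono h hJ, hU⟩

lemma primaryCoeffs_mono {T T' : Set (HeightOneSpectrum D)} (h : T ⊆ T') {A : Matrix ι ι R}
    (hA : ∀ m ≠ 0, (invariantSubmodules A m).Finite) (m : ℕ) :
    primaryCoeffs T A m ≤ primaryCoeffs T' A m := by
  rcases eq_or_ne m 0 with rfl | hm
  · simp
  · rw [primaryCoeffs_apply T A hm, primaryCoeffs_apply T' A hm]
    exact Set.ncard_le_ncard (Set.inter_subset_inter_right _ (primarySubmodules_mono h))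
      ((hA m hm).inter_of_left _)

lemma primaryCoeffs_empty (A : Matrix ι ι R) :
    primaryCoeffs (∅ : Set (HeightOneSpectrum D)) A = 1 := by
  have h : primarySubmodules R ι (∅ : Set (HeightOneSpectrum D)) = {⊤} := by
    ext U
    simp only [primarySubmodules, supportedIdeals, Set.image_empty, Submonoid.closure_empty,
      Submonoid.mem_bot, Set.mem_ofPred_eq, Set.mem_singleton_iff, exists_eq_left, eq_top_iff]
    constructor
    · intro hU x _
      simpa using hU 1 (by simp) x
    · exact fun hU a _ x => hU trivial
  ext m
  rcases eq_or_ne m 0 with rfl | hm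
  · simp
  rw [primaryCoeffs_apply _ A hm, h, ArithmeticFunction.one_apply]
  split_ifs with h1
  · have : invariantSubmodules A m ∩ {⊤} = {⊤} := by
      rw [Set.inter_eq_right, Set.singleton_subset_iff]
      exact ⟨fun _ _ => trivial, by rw [h1]; exact AddSubgroup.index_top⟩
    rw [this, Set.ncard_singleton]
  · have : invariantSubmodules A m ∩ {⊤} = ∅ := by
      rw [Set.inter_singleton_eq_empty]
      exact fun hU => h1 (hU.2.symm.trans AddSubgroup.index_top)
    rw [this, Set.ncard_empty]

lemma index_inf_of_sup_eq_top {G : Type*} [AddCommGroup G] {H K : AddSubgroup G}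
    (h : H ⊔ K = ⊤) : (H ⊓ K).index = H.index * K.index := by
  rw [← AddSubgroup.relIndex_mul_index (inf_le_right : H ⊓ K ≤ K), AddSubgroup.inf_relIndex_right,
    ← AddSubgroup.relIndex_sup_right K H, sup_comm, h, AddSubgroup.relIndex_top_right]

lemma exists_add_eq_of_isCoprime {I I' : Ideal D} (h : IsCoprime I I') :
    ∃ a ∈ I, ∃ b ∈ I', ∀ x : ι → R, x = a • x + b • x := by
  obtain ⟨a, ha, b, hb, hab⟩ := Ideal.isCoprime_iff_exists.mp h
  exact ⟨a, ha, b, hb, fun x => by rw [← add_smul, hab, one_smul]⟩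

lemma sup_eq_top_of_primary {T T' : Set (HeightOneSpectrum D)} (hT : Disjoint T T')
    {U V : Submodule R (ι → R)} (hU : U ∈ primarySubmodules R ι T)
    (hV : V ∈ primarySubmodules R ι T') : U ⊔ V = ⊤ := by
  obtain ⟨I, hI, hU⟩ := hU
  obtain ⟨I', hI', hV⟩ := hV
  obtain ⟨a, ha, b, hb, hab⟩ :=
    exists_add_eq_of_isCoprime (R := R) (ι := ι) (isCoprime_of_mem_supportedIdeals hT hI hI')
  refine eq_top_iff.mpr fun x _ => ?_
  rw [hab x]
  exact Submodule.add_mem_sup (hU a ha x) (hV b hb x)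

lemma inf_mem_primarySubmodules {T T' : Set (HeightOneSpectrum D)} {U V : Submodule R (ι → R)}
    (hU : U ∈ primarySubmodules R ι T) (hV : V ∈ primarySubmodules R ι T') :
    U ⊓ V ∈ primarySubmodules R ι (T ∪ T') := by
  obtain ⟨I, hI, hIU⟩ := hU
  obtain ⟨I', hI', hIV⟩ := hV
  refine ⟨I * I', mul_mem (supportedIdeals_mono Set.subset_union_left hI)
    (supportedIdeals_mono Set.subset_union_right hI'), fun a ha x => ?_⟩
  have h1 : a ∈ I := (Ideal.mul_le_left : I * I' ≤ I) ha
  have h2 : a ∈ I' := (Ideal.mul_le_right : I * I' ≤ I') ha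
  exact Submodule.mem_inf.mpr ⟨hIU a h1 x, hIV a h2 x⟩

/-- Write x = ax + bx with a ∈ I, b ∈ I' and a + b = 1: then ax lies in V and bx in U ⊓ U'. This
shows that primary components are determined by their intersection. -/
lemma le_of_inf_le_of_primary {T T' : Set (HeightOneSpectrum D)} (hT : Disjoint T T')
    {U U' V : Submodule R (ι → R)} (hV : V ∈ primarySubmodules R ι T)
    (hU' : U' ∈ primarySubmodules R ι T') (h : U ⊓ U' ≤ V) : U ≤ V := by
  obtain ⟨I, hI, hV⟩ := hV
  obtain ⟨I', hI', hU'⟩ := hU'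
  obtain ⟨a, ha, b, hb, hab⟩ :=
    exists_add_eq_of_isCoprime (R := R) (ι := ι) (isCoprime_of_mem_supportedIdeals hT hI hI')
  intro x hx
  rw [hab x]
  refine V.add_mem (hV a ha x) (h ⟨?_, hU' b hb x⟩)
  rw [← algebraMap_smul R b x]
  exact U.smul_mem _ hx

/-- The submodule of all `x` with `I x ⊆ U`. -/
def colonIdeal (U : Submodule R (ι → R)) (I : Ideal D) : Submodule R (ι → R) where
  carrier := {x | ∀ a ∈ I, a • x ∈ U}
  add_mem' hx hy a ha := by rw [smul_add]; exact U.add_mem (hx a ha) (hy a ha)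
  zero_mem' a _ := by rw [smul_zero]; exact U.zero_mem
  smul_mem' c x hx a ha := by rw [smul_comm]; exact U.smul_mem c (hx a ha)

lemma vecMul_mem_colonIdeal {A : Matrix ι ι R} {U : Submodule R (ι → R)}
    (hU : ∀ x ∈ U, Matrix.vecMul x A ∈ U) (I : Ideal D) :
    ∀ x ∈ colonIdeal U I, Matrix.vecMul x A ∈ colonIdeal U I := fun x hx a ha => by
  rw [← Matrix.smul_vecMul]
  exact hU _ (hx a ha)

/-- If I I' R^ι ⊆ U, the components are the x with I' x ⊆ U, which include I R^ι, and the x with I x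
⊆ U. An x in both lies in U because I + I' = 1. -/
lemma exists_inf_eq_of_primary {T T' : Set (HeightOneSpectrum D)} (hT : Disjoint T T')
    {A : Matrix ι ι R} {U : Submodule R (ι → R)} (hU : ∀ x ∈ U, Matrix.vecMul x A ∈ U)
    (hUT : U ∈ primarySubmodules R ι (T ∪ T')) :
    ∃ V ∈ primarySubmodules R ι T, ∃ V' ∈ primarySubmodules R ι T',
      (∀ x ∈ V, Matrix.vecMul x A ∈ V) ∧ (∀ x ∈ V', Matrix.vecMul x A ∈ V') ∧ V ⊓ V' = U := by
  obtain ⟨J, hJ, hJU⟩ := hUT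
  obtain ⟨I, hI, I', hI', rfl⟩ := exists_mul_of_mem_supportedIdeals_union hJ
  refine ⟨colonIdeal U I', ⟨I, hI, fun a ha x b hb => ?_⟩, colonIdeal U I,
    ⟨I', hI', fun b hb x a ha => ?_⟩, vecMul_mem_colonIdeal hU _, vecMul_mem_colonIdeal hU _,
    le_antisymm ?_ ?_⟩
  · rw [smul_smul, mul_comm]
    exact hJU _ (Ideal.mul_mem_mul ha hb) x
  · rw [smul_smul]
    exact hJU _ (Ideal.mul_mem_mul ha hb) x
  · obtain ⟨a, ha, b, hb, hab⟩ :=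
      exists_add_eq_of_isCoprime (R := R) (ι := ι) (isCoprime_of_mem_supportedIdeals hT hI hI')
    rintro x ⟨hx, hx'⟩
    rw [hab x]
    exact U.add_mem (hx' a ha) (hx b hb)
  · have : ∀ (x) (_ : x ∈ U) (a : D), a • x ∈ U := fun x hx a => by
      rw [← algebraMap_smul R a x]
      exact U.smul_mem _ hx
    exact fun x hx => ⟨fun a _ => this x hx a, fun a _ => this x hx a⟩

/-- Pairs of components correspond bijectively to their intersections, and the index of the
intersection is the product because the components together span everything. Counting pairs by index
is Dirichlet convolution. -/
lemma primaryCoeffs_union {T T' : Set (HeightOneSpectrum D)} (hT : Disjoint T T')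
    {A : Matrix ι ι R} (hA : ∀ m ≠ 0, (invariantSubmodules A m).Finite) :
    primaryCoeffs (T ∪ T') A = primaryCoeffs T A * primaryCoeffs T' A := by
  classical
  ext m
  rcases eq_or_ne m 0 with rfl | hm
  · simp
  have hfin : ∀ (T : Set (HeightOneSpectrum D)) (d : ℕ), d ≠ 0 →
      (invariantSubmodules A d ∩ primarySubmodules R ι T).Finite :=
    fun T d hd => (hA d hd).inter_of_left _
  let F : Set (HeightOneSpectrum D) → ℕ → Finset (Submodule R (ι → R)) := fun T d =>
    if hd : d ≠ 0 then (hfin T d hd).toFinset else ∅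
  have hF : ∀ T d U, d ≠ 0 →
      (U ∈ F T d ↔ U ∈ invariantSubmodules A d ∧ U ∈ primarySubmodules R ι T) := fun T d U hd => by
    simp [F, hd]
  have hcard : ∀ T d, d ≠ 0 → primaryCoeffs T A d = (F T d).card := fun T d hd => by
    rw [primaryCoeffs_apply T A hd, Set.ncard_eq_toFinset_card _ (hfin T d hd)]
    simp [F, hd]
  clear_value F
  rw [ArithmeticFunction.mul_apply, hcard _ _ hm]
  have hne : ∀ p ∈ m.divisorsAntidiagonal, p.1 ≠ 0 ∧ p.2 ≠ 0 := fun p hp => by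
    have := (Nat.mem_divisorsAntidiagonal.mp hp)
    constructor <;> rintro h <;> simp [h] at this <;> omega
  rw [Finset.sum_congr rfl fun p hp => by
    rw [hcard T _ (hne p hp).1, hcard T' _ (hne p hp).2, ← Finset.card_product],
    ← Finset.card_sigma]
  symm
  refine Finset.card_bij (fun q _ => q.2.1 ⊓ q.2.2) ?_ ?_ ?_
  · rintro ⟨p, U, V⟩ h
    rw [Finset.mem_sigma, Finset.mem_product] at h
    obtain ⟨hp, hU, hV⟩ := h
    rw [hF _ _ _ (hne p hp).1] at hU
    rw [hF _ _ _ (hne p hp).2] at hV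
    rw [hF _ _ _ hm]
    refine ⟨⟨fun x hx => ⟨hU.1.1 x hx.1, hV.1.1 x hx.2⟩, ?_⟩, ?_⟩
    · have := index_inf_of_sup_eq_top (H := U.toAddSubgroup) (K := V.toAddSubgroup) (by
        rw [← Submodule.sup_toAddSubgroup, sup_eq_top_of_primary hT hU.2 hV.2]
        rfl)
      rw [hU.1.2, hV.1.2, (Nat.mem_divisorsAntidiagonal.mp hp).1] at this
      exact this
    · exact inf_mem_primarySubmodules hU.2 hV.2
  · rintro ⟨p, U, V⟩ h ⟨p', U', V'⟩ h' heq
    rw [Finset.mem_sigma, Finset.mem_product] at h h'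
    obtain ⟨hp, hU, hV⟩ := h
    obtain ⟨hp', hU', hV'⟩ := h'
    rw [hF _ _ _ (hne p hp).1] at hU
    rw [hF _ _ _ (hne p hp).2] at hV
    rw [hF _ _ _ (hne p' hp').1] at hU'
    rw [hF _ _ _ (hne p' hp').2] at hV'
    dsimp only at *
    obtain rfl : U = U' := le_antisymm
      (le_of_inf_le_of_primary hT hU'.2 hV.2 (heq.le.trans inf_le_left))
      (le_of_inf_le_of_primary hT hU.2 hV'.2 (heq.ge.trans inf_le_left))
    obtain rfl : V = V' := le_antisymm
      (le_of_inf_le_of_primary hT.symm hV'.2 hU.2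
        ((inf_comm V U).le.trans (heq.le.trans inf_le_right)))
      (le_of_inf_le_of_primary hT.symm hV.2 hU'.2
        ((inf_comm V' U).le.trans (heq.ge.trans inf_le_right)))
    obtain rfl : p = p' := Prod.ext (hU.1.2.symm.trans hU'.1.2) (hV.1.2.symm.trans hV'.1.2)
    rfl
  · intro U hU
    rw [hF _ _ _ hm] at hU
    obtain ⟨V, hV, V', hV', hVA, hVA', rfl⟩ := exists_inf_eq_of_primary hT hU.1.1 hU.2
    have hi := index_inf_of_sup_eq_top (H := V.toAddSubgroup) (K := V'.toAddSubgroup) (by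
        rw [← Submodule.sup_toAddSubgroup, sup_eq_top_of_primary hT hV hV']
        rfl)
    have hp : (V.toAddSubgroup.index, V'.toAddSubgroup.index) ∈ m.divisorsAntidiagonal :=
      Nat.mem_divisorsAntidiagonal.mpr ⟨hi.symm.trans hU.1.2, hm⟩
    refine ⟨⟨(V.toAddSubgroup.index, V'.toAddSubgroup.index), V, V'⟩, ?_, rfl⟩
    rw [Finset.mem_sigma, Finset.mem_product]
    exact ⟨hp, (hF _ _ _ (hne _ hp).1).mpr ⟨⟨hVA, rfl⟩, hV⟩,
      (hF _ _ _ (hne _ hp).2).mpr ⟨⟨hVA', rfl⟩, hV'⟩⟩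

lemma primaryCoeffs_eq_prod {A : Matrix ι ι R} (hA : ∀ m ≠ 0, (invariantSubmodules A m).Finite)
    (T : Finset (HeightOneSpectrum D)) :
    primaryCoeffs (T : Set (HeightOneSpectrum D)) A = ∏ w ∈ T, primaryCoeffs {w} A := by
  classical
  induction T using Finset.induction_on with
  | empty => rw [Finset.coe_empty, primaryCoeffs_empty, Finset.prod_empty]
  | insert w T hw ih =>
    rw [Finset.prod_insert hw, Finset.coe_insert, Set.insert_eq,
      primaryCoeffs_union (by simpa using hw) hA, ih]

end PrimarySubmodules

/-! ### Finite-index submodules along a dense ring homomorphism. -/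

section Density

variable {R R' ι : Type*} [CommRing R] [CommRing R'] [Fintype ι]

/-- The map `R^ι → R'^ι` induced by a ring homomorphism `R → R'`. -/
def mapVec (ι : Type*) (φ : R →+* R') : (ι → R) →ₛₗ[φ] (ι → R') where
  toFun x i := φ (x i)
  map_add' x y := by ext; simp
  map_smul' c x := by ext; simp

lemma mapVec_vecMul (φ : R →+* R') (x : ι → R) (A : Matrix ι ι R) :
    mapVec ι φ (Matrix.vecMul x A) = Matrix.vecMul (mapVec ι φ x) (A.map φ) := by
  ext i
  exact RingHom.map_vecMul φ A x i

lemma index_comap_mapVec (φ : R →+* R') {U : Submodule R' (ι → R')}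
    (hU : ∀ x, ∃ a, x - mapVec ι φ a ∈ U) :
    (U.comap (mapVec ι φ)).toAddSubgroup.index = U.toAddSubgroup.index := by
  have h : (U.comap (mapVec ι φ)).toAddSubgroup =
    U.toAddSubgroup.comap (mapVec ι φ).toAddMonoidHom := rfl
  have htop : (mapVec ι φ).toAddMonoidHom.range ⊔ U.toAddSubgroup = ⊤ := by
    refine eq_top_iff.mpr fun x _ => ?_
    obtain ⟨a, ha⟩ := hU x
    rw [← add_sub_cancel (mapVec ι φ a) x]
    exact AddSubgroup.add_mem_sup ⟨a, rfl⟩ ha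
  rw [h, AddSubgroup.index_comap, ← AddSubgroup.relIndex_sup_right, htop,
    AddSubgroup.relIndex_top_right]

variable {D : Type*} [CommRing D] [IsDedekindDomain D] [Algebra D R]

/-- If `R → R'` has dense image for a filtration of `R'` by ideals that induces the `w`-adic
filtration on `R`, then the finite index submodules over `R'` correspond to the `w`-primary ones
over `R`. -/
lemma coeffs_map_eq_primaryCoeffs (φ : R →+* R') (B : ℕ → Ideal R') (w : HeightOneSpectrum D)
    (hdense : ∀ N x, ∃ a, x - φ a ∈ B N)
    (hB : ∀ N, ∀ a ∈ w.asIdeal ^ N, φ (algebraMap D R a) ∈ B N)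
    (hcomap : ∀ N r, φ r ∈ B N → r ∈ (w.asIdeal ^ N).map (algebraMap D R))
    (hm : ∀ m : ℕ, m ≠ 0 → ∃ N, ∀ y ∈ B N, ∃ z, y = m • z) (A : Matrix ι ι R) :
    coeffs (A.map φ) = primaryCoeffs {w} A := by
  classical
  have hdense' : ∀ N (x : ι → R'), ∃ a : ι → R, ∀ i, (x - mapVec ι φ a) i ∈ B N := fun N x => by
    choose a ha using fun i => hdense N (x i)
    exact ⟨a, ha⟩
  -- A submodule of index m contains m R'^ι, hence all vectors with entries in B N, where N depends
  -- on m alone.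
  have hmem : ∀ m : ℕ, m ≠ 0 → ∃ N, ∀ U : Submodule R' (ι → R'), U.toAddSubgroup.index = m →
      ∀ x : ι → R', (∀ i, x i ∈ B N) → x ∈ U := fun m hm0 => by
    obtain ⟨N, hN⟩ := hm m hm0
    refine ⟨N, fun U hU x hx => ?_⟩
    choose z hz using fun i => hN _ (hx i)
    have : x = m • z := funext hz
    rw [this, ← hU]
    exact U.toAddSubgroup.nsmul_index_mem z
  ext m
  rcases eq_or_ne m 0 with rfl | hm0
  · simp
  rw [coeffs_apply _ hm0, primaryCoeffs_apply _ _ hm0]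
  obtain ⟨N, hN⟩ := hmem m hm0
  refine Set.BijOn.ncard_eq (f := fun U => U.comap (mapVec ι φ)) ⟨?_, ?_, ?_⟩
  · rintro U ⟨hUA, hUm⟩
    refine ⟨⟨fun x hx => ?_, ?_⟩, w.asIdeal ^ N, mem_supportedIdeals_singleton.mpr ⟨N, rfl⟩,
      fun a ha x => ?_⟩
    · rw [Submodule.mem_comap, mapVec_vecMul]
      exact hUA _ hx
    · rw [index_comap_mapVec, hUm]
      intro x
      obtain ⟨a, ha⟩ := hdense' N x
      exact ⟨a, hN U hUm _ ha⟩
    · refine hN U hUm _ fun i => ?_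
      change φ (a • x i) ∈ B N
      rw [Algebra.smul_def, map_mul]
      exact (B N).mul_mem_right _ (hB N a ha)
  · have key : ∀ U V : Submodule R' (ι → R'), U.toAddSubgroup.index = m →
        V.toAddSubgroup.index = m → U.comap (mapVec ι φ) ≤ V.comap (mapVec ι φ) → U ≤ V := by
      intro U V hU hV hUV x hx
      obtain ⟨a, ha⟩ := hdense' N x
      have h1 : mapVec ι φ a ∈ U := by
        have := U.sub_mem hx (hN U hU _ ha)
        rwa [sub_sub_cancel] at this
      have h2 := V.add_mem (hUV h1) (hN V hV _ ha)
      rwa [add_sub_cancel] at h2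
    rintro U ⟨-, hU⟩ V ⟨-, hV⟩ hUV
    exact le_antisymm (key U V hU hV hUV.le) (key V U hV hU hUV.ge)
  · rintro U ⟨⟨hUA, hUm⟩, J, hJ, hJU⟩
    obtain ⟨N, rfl⟩ := mem_supportedIdeals_singleton.mp hJ
    have hsmall : ∀ x : ι → R, (∀ i, φ (x i) ∈ B N) → x ∈ U := fun x hx => by
      have : x = ∑ i, x i • (Pi.single i 1 : ι → R) := pi_eq_sum_univ' x
      rw [this]
      refine U.sum_mem fun i _ => ?_
      have h := hcomap N _ (hx i)
      generalize x i = r at h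
      induction h using Submodule.span_induction with
      | mem y hy =>
        obtain ⟨a, ha, rfl⟩ := hy
        rw [algebraMap_smul]
        exact hJU a ha _
      | zero => rw [zero_smul]; exact U.zero_mem
      | add y z _ _ hy hz => rw [add_smul]; exact U.add_mem hy hz
      | smul c y _ hy => rw [smul_eq_mul, mul_smul]; exact U.smul_mem c hy
    -- The inverse of pulling back is the closure, the image of U plus (B N)^ι. Here N is the
    -- exponent with w^N R^ι ⊆ U, so by `hsmall` pulling back returns U exactly.
    let V : Submodule R' (ι → R') :=
      { carrier := {x | ∃ u ∈ U, ∀ i, (x - mapVec ι φ u) i ∈ B N}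
        zero_mem' := ⟨0, U.zero_mem, fun i => by simp⟩
        add_mem' := by
          rintro x y ⟨u, hu, hxu⟩ ⟨v, hv, hyv⟩
          refine ⟨u + v, U.add_mem hu hv, fun i => ?_⟩
          rw [map_add, add_sub_add_comm]
          exact (B N).add_mem (hxu i) (hyv i)
        smul_mem' := by
          rintro c x ⟨u, hu, hxu⟩
          obtain ⟨r, hr⟩ := hdense N c
          refine ⟨r • u, U.smul_mem r hu, fun i => ?_⟩
          have : (c • x - mapVec ι φ (r • u)) i =
              c * (x - mapVec ι φ u) i + mapVec ι φ u i * (c - φ r) := by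
            simp only [map_smulₛₗ, Pi.sub_apply, Pi.smul_apply, smul_eq_mul]
            ring
          rw [this]
          exact (B N).add_mem ((B N).mul_mem_left _ (hxu i)) ((B N).mul_mem_left _ hr) }
    have hcomapV : V.comap (mapVec ι φ) = U := by
      ext x
      constructor
      · rintro ⟨u, hu, hxu⟩
        have : x - u ∈ U := hsmall _ fun i => by
          have := hxu i
          rw [← map_sub] at this
          exact this
        simpa using U.add_mem this hu
      · exact fun hx => ⟨x, hx, fun i => by simp⟩
    refine ⟨V, ⟨?_, ?_⟩, hcomapV⟩
    · rintro x ⟨u, hu, hxu⟩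
      refine ⟨Matrix.vecMul u A, hUA u hu, fun i => ?_⟩
      rw [mapVec_vecMul, ← Matrix.sub_vecMul]
      exact (B N).sum_mem fun j _ => (B N).mul_mem_right _ (hxu j)
    · rw [← index_comap_mapVec φ, hcomapV, hUm]
      intro x
      obtain ⟨a, ha⟩ := hdense' N x
      exact ⟨a, 0, U.zero_mem, by simpa using ha⟩

end Density

/-! ### Completions at places outside S. -/

section Completion

open WithZero

variable {K : Type*} [Field K] [NumberField K]

lemma isOpen_setOf_valued_lt (w : HeightOneSpectrum (𝓞 K)) (γ : WithZero (Multiplicative ℤ)) :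
    IsOpen {z : w.adicCompletion K | Valued.v z < γ} := by
  obtain ⟨q, rfl⟩ := HeightOneSpectrum.valuedAdicCompletion_surjective K w γ
  have : {z : w.adicCompletion K | Valued.v z < Valued.v q} =
      {z | Valued.v.restrict z < Valued.v.restrict q} :=
    Set.ext fun z => by
      change Valued.v z < Valued.v q ↔ Valued.v.restrict z < Valued.v.restrict q
      exact (Valuation.restrict_lt_iff _).symm
  rw [this]
  exact Valued.isOpen_ball _ _

/-- Two approximations are combined: K is dense in its completion, and an element of K integral at w
is w-adically close to an element of 𝓞 K. -/
lemma exists_algebraMap_sub_le (w : HeightOneSpectrum (𝓞 K)) (N : ℕ)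
    (x : w.adicCompletionIntegers K) : ∃ a : 𝓞 K,
      Valued.v ((x - algebraMap (𝓞 K) (w.adicCompletionIntegers K) a :
        w.adicCompletionIntegers K) : w.adicCompletion K) ≤ exp (-(N : ℤ)) := by
  have hN : exp (-(N : ℤ)) ≤ 1 := by
    rw [← exp_zero, exp_le_exp]
    omega
  obtain ⟨y, hy⟩ : ∃ y : K, Valued.v ((x : w.adicCompletion K) -
      algebraMap K (w.adicCompletion K) y) < exp (-(N : ℤ)) := by
    have hopen : IsOpen {z : w.adicCompletion K | Valued.v z < exp (-(N : ℤ))} :=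
      isOpen_setOf_valued_lt w _
    exact (HeightOneSpectrum.denseRange_algebraMap K w).exists_mem_open
      (hopen.preimage (continuous_const.sub continuous_id)) ⟨x, by simp⟩
  have hy1 : w.valuation K y ≤ 1 := by
    rw [← HeightOneSpectrum.valuedAdicCompletion_eq_valuation' w y]
    have : (y : w.adicCompletion K) = x - (x - algebraMap K (w.adicCompletion K) y) := by
      rw [sub_sub_cancel]; rfl
    rw [this]
    exact Valuation.map_sub_le Valued.v x.2 (hy.le.trans hN)
  obtain ⟨a, ha⟩ := w.exists_valuation_sub_lt_of_integer hy1
    (Units.mk0 (exp (-(N : ℤ))) exp_ne_zero)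
  refine ⟨a, ?_⟩
  have : ((x - algebraMap (𝓞 K) (w.adicCompletionIntegers K) a : w.adicCompletionIntegers K) :
      w.adicCompletion K) = (x - algebraMap K (w.adicCompletion K) y) -
        algebraMap K (w.adicCompletion K) (algebraMap (𝓞 K) K a - y) := by
    rw [map_sub, sub_sub_sub_cancel_right]
    rfl
  rw [this]
  refine Valuation.map_sub_le Valued.v hy.le ?_
  exact (HeightOneSpectrum.valuedAdicCompletion_eq_valuation' w _).le.trans ha.le

lemma exists_eq_nsmul_of_valuation_le (w : HeightOneSpectrum (𝓞 K)) {m : ℕ} (hm : m ≠ 0) :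
    ∃ N : ℕ, ∀ y : w.adicCompletionIntegers K,
      Valued.v (y : w.adicCompletion K) ≤ exp (-(N : ℤ)) → ∃ z, y = m • z := by
  have hm1 : algebraMap K (w.adicCompletion K) m ≠ 0 := by
    rw [ne_eq, map_eq_zero]
    exact_mod_cast hm
  have hm0 : Valued.v (algebraMap K (w.adicCompletion K) m) ≠ 0 := by
    rwa [ne_eq, map_eq_zero]
  obtain ⟨N, hN, -⟩ := exists_exp_neg_natCast_lt_and_lt hm0 hm0
  refine ⟨N, fun y hy => ⟨⟨(algebraMap K (w.adicCompletion K) m)⁻¹ * y, ?_⟩, ?_⟩⟩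
  · rw [HeightOneSpectrum.mem_adicCompletionIntegers, map_mul, map_inv₀,
      inv_mul_le_one₀ (zero_lt_iff.mpr hm0)]
    exact hy.trans hN.le
  · apply Subtype.ext
    rw [nsmul_eq_mul]
    change (y : w.adicCompletion K) = ((m : w.adicCompletionIntegers K) : w.adicCompletion K) *
      ((algebraMap K (w.adicCompletion K) m)⁻¹ * y)
    have : ((m : w.adicCompletionIntegers K) : w.adicCompletion K) =
      algebraMap K (w.adicCompletion K) m := by simp
    rw [this, mul_inv_cancel_left₀ hm1]

/-- The inclusion of the `S`-integers into the completed local ring at a place outside `S`. -/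
def integerToCompletion {S : Set (HeightOneSpectrum (𝓞 K))} {w : HeightOneSpectrum (𝓞 K)}
    (hw : w ∉ S) : S.integer K →+* w.adicCompletionIntegers K :=
  ((algebraMap K (w.adicCompletion K)).comp (S.integer K).val.toRingHom).codRestrict
    (w.adicCompletionIntegers K).toSubring fun x =>
      (HeightOneSpectrum.valuedAdicCompletion_eq_valuation' w (x : K)).le.trans (x.2 w hw)

lemma valued_integerToCompletion {S : Set (HeightOneSpectrum (𝓞 K))}
    {w : HeightOneSpectrum (𝓞 K)} (hw : w ∉ S) (x : S.integer K) :
    Valued.v (integerToCompletion hw x : w.adicCompletion K) = w.valuation K x :=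
  HeightOneSpectrum.valuedAdicCompletion_eq_valuation' w (x : K)

lemma hasZeta_completion (w : HeightOneSpectrum (𝓞 K)) {ι : Type*} [Fintype ι]
    (A : Matrix ι ι (w.adicCompletionIntegers K)) : HasZeta A := by
  refine hasZeta_of_forall_exists (K := K)
    (algebraMap (𝓞 K) (w.adicCompletionIntegers K)).toAddMonoidHom (fun m hm x => ?_) A
  obtain ⟨N, hN⟩ := exists_eq_nsmul_of_valuation_le w hm
  obtain ⟨a, ha⟩ := exists_algebraMap_sub_le w N x
  obtain ⟨z, hz⟩ := hN _ ha
  exact ⟨a, z, sub_eq_iff_eq_add'.mp hz⟩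

/-- The ideal of all elements of valuation at most `exp (-N)`. -/
def completionBall (w : HeightOneSpectrum (𝓞 K)) (N : ℕ) : Ideal (w.adicCompletionIntegers K) where
  carrier := {x | Valued.v (x : w.adicCompletion K) ≤ exp (-(N : ℤ))}
  zero_mem' := by simp
  add_mem' {x y} hx hy := by
    change Valued.v ((x : w.adicCompletion K) + y) ≤ _
    exact Valuation.map_add_le Valued.v hx hy
  smul_mem' c x hx := by
    change Valued.v ((c : w.adicCompletion K) * x) ≤ _
    rw [map_mul]
    exact (mul_le_of_le_one_left' c.2).trans hx

lemma inv_mem_integer {S : Set (HeightOneSpectrum (𝓞 K))} {c : 𝓞 K}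
    (hc : ∀ v ∉ S, c ∉ v.asIdeal) : (algebraMap (𝓞 K) K c)⁻¹ ∈ S.integer K := fun v hv => by
  rw [map_inv₀, (HeightOneSpectrum.valuation_eq_one_iff_notMem v).mpr (hc v hv), inv_one]

/-- The density criterion is applied to the filtration by balls. Its delicate hypothesis is that an
S-integer of valuation at most exp(-N) lies in the extension of w^N: its denominator c is invertible
among the S-integers and a unit at w, so the numerator lies in w^N. -/
lemma coeffs_map_integerToCompletion {S : Set (HeightOneSpectrum (𝓞 K))}
    {w : HeightOneSpectrum (𝓞 K)} (hw : w ∉ S) {ι : Type*} [Fintype ι]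
    (A : Matrix ι ι (S.integer K)) :
    coeffs (A.map (integerToCompletion hw)) = primaryCoeffs {w} A := by
  refine coeffs_map_eq_primaryCoeffs _ (completionBall w) w (fun N x => ?_) (fun N a ha => ?_)
    (fun N r hr => ?_) (fun m hm => exists_eq_nsmul_of_valuation_le w hm) A
  · obtain ⟨a, ha⟩ := exists_algebraMap_sub_le w N x
    exact ⟨algebraMap _ _ a, ha⟩
  · refine (valued_integerToCompletion hw _).le.trans ?_
    exact (w.valuation_of_algebraMap a).le.trans ((w.intValuation_le_pow_iff_mem a N).mpr ha)
  · have hr : w.valuation K r ≤ exp (-(N : ℤ)) := (valued_integerToCompletion hw r).ge.trans hr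
    obtain ⟨c, hc0, hc, y, hy⟩ := exists_mul_eq_algebraMap (k := K) (k' := K) S (x := (r : K))
      (by rw [placesAbove_self]; exact r.2)
    have hc1 : algebraMap (𝓞 K) K c ≠ 0 := by simpa using hc0
    have hy : algebraMap (𝓞 K) K c * r = algebraMap (𝓞 K) K y := hy
    have hyN : y ∈ w.asIdeal ^ N := by
      rw [← w.intValuation_le_pow_iff_mem, ← w.valuation_of_algebraMap (K := K)]
      change w.valuation K (algebraMap (𝓞 K) K y) ≤ _
      rw [← hy, map_mul,
        (HeightOneSpectrum.valuation_eq_one_iff_notMem w).mpr (hc w hw), one_mul]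
      exact hr
    have : r = ⟨_, inv_mem_integer hc⟩ * algebraMap (𝓞 K) (S.integer K) y := by
      ext
      change (r : K) = (algebraMap (𝓞 K) K c)⁻¹ * algebraMap (𝓞 K) K y
      rw [← hy, inv_mul_cancel_left₀ hc1]
    rw [this]
    exact Ideal.mul_mem_left _ _ (Ideal.mem_map_of_mem _ hyN)

end Completion

/-! ### Convergence over rings of S-integers. -/

section SIntegers

variable {k k' : Type*} [Field k] [NumberField k] [Field k'] [NumberField k'] [Algebra k k']

/-- 𝓞 k' surjects onto the S'-integers modulo m. By pigeonhole b^i ≡ b^{i+d+1} modulo m for the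
denominator b of x; since b is invertible among the S'-integers, x ≡ b^{d+1} x = b^d y with y = bx
integral. -/
lemma hasZeta_integer (S : Set (HeightOneSpectrum (𝓞 k))) {ι : Type*} [Fintype ι]
    (A : Matrix ι ι ((placesAbove k k' S).integer k')) : HasZeta A := by
  refine hasZeta_of_forall_exists (K := k')
    (algebraMap (𝓞 k') ((placesAbove k k' S).integer k')).toAddMonoidHom (fun m hm x => ?_) A
  obtain ⟨c, hc0, hc, y, hy⟩ := exists_mul_eq_algebraMap S x.2
  have hcS : ∀ w ∉ placesAbove k k' S, algebraMap (𝓞 k) (𝓞 k') c ∉ w.asIdeal := fun w hw => by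
    rw [algebraMap_mem_iff_mem_under]
    exact hc _ fun h => hw (mem_placesAbove_iff.mpr h)
  have hb0 : algebraMap (𝓞 k') k' (algebraMap (𝓞 k) (𝓞 k') c) ≠ 0 := by
    simpa using hc0
  generalize algebraMap (𝓞 k) (𝓞 k') c = b at hy hcS hb0
  have : Finite (𝓞 k' ⧸ Ideal.span {(m : 𝓞 k')}) :=
    Ideal.finiteQuotientOfFreeOfNeBot _ (by simpa using hm)
  obtain ⟨i, j, hij, hbij⟩ := Finite.exists_ne_map_eq_of_infinite
    (fun i : ℕ => Ideal.Quotient.mk (Ideal.span {(m : 𝓞 k')}) (b ^ i))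
  wlog hlt : i < j generalizing i j
  · exact this j i hij.symm hbij.symm (lt_of_le_of_ne (not_lt.mp hlt) hij.symm)
  obtain ⟨d, rfl⟩ := Nat.exists_eq_add_of_lt hlt
  obtain ⟨t, ht⟩ := Ideal.mem_span_singleton'.mp ((Ideal.Quotient.eq).mp hbij)
  refine ⟨b ^ d * y, algebraMap (𝓞 k') _ t * ⟨_, inv_mem_integer hcS⟩ ^ i * x, ?_⟩
  apply Subtype.ext
  rw [nsmul_eq_mul]
  have ht' := congrArg (algebraMap (𝓞 k') k') ht
  change (x : k') = algebraMap (𝓞 k') k' (b ^ d * y) + ((m : (placesAbove k k' S).integer k') : k') *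
    (algebraMap (𝓞 k') k' t * (algebraMap (𝓞 k') k' b)⁻¹ ^ i * x)
  have hmc : ((m : (placesAbove k k' S).integer k') : k') = m := by simp
  simp only [map_mul, map_pow, map_sub, ← hy, map_natCast, hmc] at ht' ⊢
  have hp : algebraMap (𝓞 k') k' b ^ i * (algebraMap (𝓞 k') k' b)⁻¹ ^ i = 1 := by
    rw [← mul_pow, mul_inv_cancel₀ hb0, one_pow]
  linear_combination (-(x : k') * (algebraMap (𝓞 k') k' b)⁻¹ ^ i) * ht' -
    (x : k') * (1 - algebraMap (𝓞 k') k' b ^ (d + 1)) * hp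

end SIntegers

/-! ### Companion matrices as multiplication operators. -/

section Blocks

/-- On the powers of a root t of g, the companion matrix is multiplication by t; its last row
encodes g(t) = 0. The base change φ allows two uses: g = f^e with t the class of X, and g = X^e over
k' with t the class of f. -/
lemma sum_companion_mul_pow {R L : Type*} [CommRing R] [CommRing L] (φ : R →+* L) {g : R[X]}
    (hg : g.Monic) {t : L} (ht : g.eval₂ φ t = 0) (d : ℕ) (hd : g.natDegree = d) (i : Fin d) :
    ∑ j, φ (companion d g i j) * t ^ (j : ℕ) = t ^ ((i : ℕ) + 1) := by
  by_cases hi : (i : ℕ) + 1 = d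
  · simp only [companion, Matrix.of_apply, hi, if_true, map_neg, neg_mul, Finset.sum_neg_distrib]
    rw [eval₂_eq_sum_range, hd, Finset.sum_range_succ, ← hd, hg.coeff_natDegree, map_one, one_mul,
      hd, ← Fin.sum_univ_eq_sum_range (fun j => φ (g.coeff j) * t ^ j)] at ht
    exact neg_eq_of_add_eq_zero_right ht
  · have hlt : (i : ℕ) + 1 < d := by omega
    rw [Finset.sum_eq_single ⟨(i : ℕ) + 1, hlt⟩]
    · simp [companion, hi]
    · intro j _ hj
      have : (i : ℕ) + 1 ≠ j := fun h => hj (Fin.ext h.symm)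
      simp [companion, hi, this]
    · simp

lemma sum_vecMul_companion {R L : Type*} [CommRing R] [CommRing L] (φ : R →+* L) {g : R[X]}
    (hg : g.Monic) {t : L} (ht : g.eval₂ φ t = 0) (d : ℕ) (hd : g.natDegree = d) (v : Fin d → R) :
    ∑ j, φ (Matrix.vecMul v (companion d g) j) * t ^ (j : ℕ) =
      t * ∑ i, φ (v i) * t ^ (i : ℕ) := by
  simp only [Matrix.vecMul, dotProduct, map_sum, map_mul, Finset.sum_mul, mul_assoc]
  rw [Finset.sum_comm, Finset.mul_sum]
  refine Finset.sum_congr rfl fun i _ => ?_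
  rw [← Finset.mul_sum, sum_companion_mul_pow φ hg ht d hd i, pow_succ]
  ring

lemma vecMul_blockDiagonal' {R I : Type*} [CommRing R] [Fintype I] [DecidableEq I] {d : I → Type*}
    [∀ i, Fintype (d i)] (M : ∀ i, Matrix (d i) (d i) R) (v : (Σ i, d i) → R) (i : I) (j : d i) :
    Matrix.vecMul v (Matrix.blockDiagonal' M) ⟨i, j⟩ =
      Matrix.vecMul (fun j => v ⟨i, j⟩) (M i) j := by
  simp only [Matrix.vecMul, dotProduct, Fintype.sum_sigma]
  rw [Finset.sum_eq_single i]
  · simp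
  · intro i' _ hi'
    refine Finset.sum_eq_zero fun x _ => ?_
    rw [Matrix.blockDiagonal'_apply_ne _ _ _ hi', mul_zero]
  · simp

end Blocks

/-! ### The coefficient field of k[X]/(f^e). -/

section Primary

variable {k : Type*} [Field k] [CharZero k] {f : k[X]} [Fact (Irreducible f)]

lemma mk_pow_eq_zero (f : k[X]) (e : ℕ) : AdjoinRoot.mk (f ^ e) f ^ e = 0 := by
  rw [← map_pow, AdjoinRoot.mk_self]

/-- Newton iteration starting at the class of X: there f is nilpotent, and f' is a unit because f is
separable. -/
lemma exists_aeval_eq_zero_adjoinRoot_pow (f : k[X]) [hf : Fact (Irreducible f)] (e : ℕ) :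
    ∃ r : AdjoinRoot (f ^ e), aeval r f = 0 := by
  have h1 : IsNilpotent (aeval (AdjoinRoot.root (f ^ e)) f) :=
    ⟨e, by rw [AdjoinRoot.aeval_eq, mk_pow_eq_zero]⟩
  have h2 : IsUnit (aeval (AdjoinRoot.root (f ^ e)) (derivative f)) := by
    obtain ⟨a, b, hab⟩ := (hf.out.separable : IsCoprime f (derivative f)).pow_left (m := e)
    have := congrArg (AdjoinRoot.mk (f ^ e)) hab
    rw [map_add, map_mul, map_mul, AdjoinRoot.mk_self, mul_zero, zero_add, map_one] at this
    rw [AdjoinRoot.aeval_eq]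
    exact IsUnit.of_mul_eq_one_right _ this
  obtain ⟨r, ⟨-, hr⟩, -⟩ := existsUnique_nilpotent_sub_and_aeval_eq_zero h1 h2
  exact ⟨r, hr⟩

/-- The map `(w_j) ↦ ∑ σ(w_j) f^j`. -/
def truncatedSeries {e : ℕ} (σ : AdjoinRoot f →ₐ[k] AdjoinRoot (f ^ e)) :
    (Fin e → AdjoinRoot f) →ₗ[k] AdjoinRoot (f ^ e) where
  toFun w := ∑ j, σ (w j) * AdjoinRoot.mk (f ^ e) f ^ (j : ℕ)
  map_add' w w' := by simp [add_mul, Finset.sum_add_distrib]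
  map_smul' c w := by simp [Finset.smul_sum]

/-- The lowest nonzero coefficient, at f^j, is a unit. Multiplying by f^{e-1-j} kills all higher
terms and leaves a unit times f^{e-1}, which is nonzero modulo f^e. -/
lemma truncatedSeries_injective {e : ℕ}
    (σ : AdjoinRoot f →ₐ[k] AdjoinRoot (f ^ e)) : Function.Injective (truncatedSeries σ) := by
  have hirr : Irreducible f := Fact.out
  rw [injective_iff_map_eq_zero]
  intro w hw
  set y := AdjoinRoot.mk (f ^ e) f with hy
  have hye : y ^ e = 0 := mk_pow_eq_zero f e
  have hw : ∑ j, σ (w j) * y ^ (j : ℕ) = 0 := hw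
  suffices H : ∀ (j : ℕ) (hj : j < e), w ⟨j, hj⟩ = 0 from funext fun j => H j j.2
  intro j
  induction j using Nat.strong_induction_on with
  | _ j ih =>
    intro hj
    by_contra hne
    have h1 : σ (w ⟨j, hj⟩) * y ^ (e - 1) = 0 := by
      have := congrArg (· * y ^ (e - 1 - j)) hw
      simp only [zero_mul, Finset.sum_mul] at this
      rw [Finset.sum_eq_single ⟨j, hj⟩] at this
      · rw [mul_assoc, ← pow_add] at this
        rwa [show j + (e - 1 - j) = e - 1 by omega] at this
      · intro i _ hi
        have hi' : (i : ℕ) ≠ j := fun h => hi (Fin.ext h)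
        rcases lt_or_gt_of_ne hi' with h | h
        · rw [ih i h i.2, map_zero, zero_mul, zero_mul]
        · rw [mul_assoc, ← pow_add, pow_eq_zero_of_le (by omega) hye, mul_zero]
      · simp
    have hu : IsUnit (σ (w ⟨j, hj⟩)) := (IsUnit.mk0 _ hne).map σ
    rw [hu.mul_right_eq_zero, hy, ← map_pow, AdjoinRoot.mk_eq_zero,
      pow_dvd_pow_iff hirr.ne_zero hirr.not_isUnit] at h1
    omega

/-- Both sides have dimension e · deg f over k. -/
lemma truncatedSeries_bijective (hf : f.Monic) {e : ℕ}
    (σ : AdjoinRoot f →ₐ[k] AdjoinRoot (f ^ e)) : Function.Bijective (truncatedSeries σ) := by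
  have h1 := truncatedSeries_injective σ
  have := (AdjoinRoot.powerBasis' hf).finite
  have := (AdjoinRoot.powerBasis' (hf.pow e)).finite
  refine ⟨h1, (LinearMap.injective_iff_surjective_of_finrank_eq_finrank ?_).mp h1⟩
  rw [Module.finrank_pi_fintype, (AdjoinRoot.powerBasis' hf).finrank,
    (AdjoinRoot.powerBasis' (hf.pow e)).finrank]
  simp [natDegree_pow]

lemma truncatedSeries_smul {e : ℕ} (σ : AdjoinRoot f →ₐ[k] AdjoinRoot (f ^ e)) (c : AdjoinRoot f)
    (w : Fin e → AdjoinRoot f) : truncatedSeries σ (c • w) = σ c * truncatedSeries σ w := by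
  simp [truncatedSeries, Finset.mul_sum, mul_assoc]

lemma truncatedSeries_vecMul {e : ℕ} (σ : AdjoinRoot f →ₐ[k] AdjoinRoot (f ^ e))
    (w : Fin e → AdjoinRoot f) :
    truncatedSeries σ (Matrix.vecMul w (companion e (X ^ e))) =
      AdjoinRoot.mk (f ^ e) f * truncatedSeries σ w :=
  sum_vecMul_companion (σ : AdjoinRoot f →+* AdjoinRoot (f ^ e)) (monic_X_pow e)
    (by rw [eval₂_X_pow]; exact mk_pow_eq_zero f e) e (natDegree_X_pow e) w

/-- The map `(v_j) ↦ ∑ v_j X^j`. -/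
def powerSum {g : k[X]} (hg : g.Monic) : (Fin g.natDegree → k) ≃ₗ[k] AdjoinRoot g :=
  (AdjoinRoot.powerBasis' hg).basis.equivFun.symm

lemma powerSum_apply {g : k[X]} (hg : g.Monic) (v : Fin g.natDegree → k) :
    powerSum hg v = ∑ j, algebraMap k (AdjoinRoot g) (v j) * AdjoinRoot.root g ^ (j : ℕ) := by
  have := (AdjoinRoot.powerBasis' hg).basis.equivFun_symm_apply v
  simp only [PowerBasis.basis_eq_pow, Algebra.smul_def] at this
  exact this

lemma powerSum_vecMul {g : k[X]} (hg : g.Monic) (v : Fin g.natDegree → k) :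
    powerSum hg (Matrix.vecMul v (companion g.natDegree g)) =
      AdjoinRoot.root g * powerSum hg v := by
  rw [powerSum_apply, powerSum_apply]
  exact sum_vecMul_companion _ hg (AdjoinRoot.eval₂_root g) _ rfl v

end Primary

/-! ### One algebra carrying both matrices. -/

section CommonAlgebra

lemma get_partList_le {m : ℕ} (l : m.Partition) (i : Fin (partList l).length) :
    (partList l).get i ≤ m := by
  have h : (partList l).get i ∈ l.parts := by
    rw [← Multiset.mem_sort (r := (· ≥ ·))]
    exact List.get_mem _ _
  exact (Multiset.single_le_sum (fun _ _ => Nat.zero_le _) _ h).trans l.parts_sum.le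

/-- Row vectors of similar matrices are isomorphic. -/
def vecMulEquiv {R ι κ : Type*} [CommRing R] [Fintype ι] [DecidableEq ι] [Fintype κ]
    [DecidableEq κ] {P : Matrix ι κ R} {Q : Matrix κ ι R} (h : P * Q = 1) (h' : Q * P = 1) :
    (ι → R) ≃ₗ[R] (κ → R) :=
  { Matrix.vecMulLinear P with
    invFun := fun v => Matrix.vecMul v Q
    left_inv := fun v => by simp [Matrix.vecMul_vecMul, h]
    right_inv := fun v => by simp [Matrix.vecMul_vecMul, h'] }

/-- The algebra `k[X]/(f^e)` maps to its quotients `k[X]/(f^d)`. -/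
def reduce {k : Type*} [Field k] (f : k[X]) {d e : ℕ} (h : d ≤ e) :
    AdjoinRoot (f ^ e) →ₐ[k] AdjoinRoot (f ^ d) :=
  AdjoinRoot.liftAlgHom (f ^ e) (Algebra.ofId k _) (AdjoinRoot.root (f ^ d)) (by
    change aeval _ _ = 0
    rw [AdjoinRoot.aeval_eq, AdjoinRoot.mk_eq_zero]
    exact pow_dvd_pow f h)

lemma reduce_root {k : Type*} [Field k] (f : k[X]) {d e : ℕ} (h : d ≤ e) :
    reduce f h (AdjoinRoot.root (f ^ e)) = AdjoinRoot.root (f ^ d) :=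
  AdjoinRoot.liftAlgHom_root _ _ _ _

lemma reduce_mk {k : Type*} [Field k] (f : k[X]) {d e : ℕ} (h : d ≤ e) (g : k[X]) :
    reduce f h (AdjoinRoot.mk (f ^ e) g) = AdjoinRoot.mk (f ^ d) g := by
  rw [← AdjoinRoot.aeval_eq, ← aeval_algHom_apply, reduce_root, AdjoinRoot.aeval_eq]

/-- A primary matrix of type `λ` and the nilpotent matrix `N(λ)` over `k[X]/(f)` both describe
multiplication operators on the same commutative algebra, and these operators generate the same
algebra. -/
theorem exists_common_algebra {k : Type*} [Field k] [CharZero k] {f : k[X]} (hf : f.Monic)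
    [Fact (Irreducible f)] {n m : ℕ} (A : Matrix (Fin n) (Fin n) k) (l : m.Partition)
    (hA : Similar A (primaryForm f l)) :
    ∃ (x y : Π i : Fin (partList l).length, AdjoinRoot (f ^ (partList l).get i))
      (σ : AdjoinRoot f →ₐ[k] Π i : Fin (partList l).length, AdjoinRoot (f ^ (partList l).get i))
      (Ξ : (Fin n → k) ≃ₗ[k]
        Π i : Fin (partList l).length, AdjoinRoot (f ^ (partList l).get i))
      (Θ : ((Σ i : Fin (partList l).length, Fin ((partList l).get i)) → AdjoinRoot f) ≃ₗ[k]
        Π i : Fin (partList l).length, AdjoinRoot (f ^ (partList l).get i)),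
      (∀ v, Ξ (Matrix.vecMul v A) = x * Ξ v) ∧ (∀ c w, Θ (c • w) = σ c * Θ w) ∧
      (∀ w, Θ (Matrix.vecMul w (nilMatrix (AdjoinRoot f) l)) = y * Θ w) ∧
      y ∈ Algebra.adjoin k {x} ∧ (∀ c, σ c ∈ Algebra.adjoin k {x}) ∧
      x ∈ Algebra.adjoin k (Set.range σ ∪ {y}) := by
  classical
  obtain ⟨P, Q, hPQ, hQP, rfl⟩ := hA
  -- The root is lifted once, modulo f^m with m ≥ λ_i for all i, and then reduced to each block.
  -- Hence σ has its values in the image of k[X]/(f^m), which is k[x].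
  obtain ⟨r, hr⟩ := exists_aeval_eq_zero_adjoinRoot_pow f m
  let σ₀ : AdjoinRoot f →ₐ[k] AdjoinRoot (f ^ m) :=
    AdjoinRoot.liftAlgHom f (Algebra.ofId k _) r hr
  let ϖ : AdjoinRoot (f ^ m) →ₐ[k]
      Π i : Fin (partList l).length, AdjoinRoot (f ^ (partList l).get i) :=
    AlgHom.pi fun i => reduce f (get_partList_le l i)
  let σ := fun i : Fin (partList l).length => (reduce f (get_partList_le l i)).comp σ₀
  have hϖ : ∀ z, ϖ z ∈ Algebra.adjoin k {ϖ (AdjoinRoot.root (f ^ m))} := fun z => by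
    have hz : z ∈ Algebra.adjoin k {AdjoinRoot.root (f ^ m)} := by
      rw [AdjoinRoot.adjoinRoot_eq_top]
      trivial
    have := Subalgebra.mem_map.mpr ⟨z, hz, (rfl : ϖ z = ϖ z)⟩
    rwa [AlgHom.map_adjoin, Set.image_singleton] at this
  refine ⟨ϖ (AdjoinRoot.root (f ^ m)), ϖ (AdjoinRoot.mk (f ^ m) f), ϖ.comp σ₀,
    (vecMulEquiv hPQ hQP).trans ((LinearEquiv.piCurry k fun _ _ => k).trans
      (LinearEquiv.piCongrRight fun i => powerSum (hf.pow _))),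
    (LinearEquiv.piCurry k fun _ _ => AdjoinRoot f).trans
      (LinearEquiv.piCongrRight fun i => LinearEquiv.ofBijective (truncatedSeries (σ i))
        (truncatedSeries_bijective hf (σ i))), fun v => ?_, fun c w => ?_, fun w => ?_, hϖ _,
    fun c => hϖ _, ?_⟩
  · have h : vecMulEquiv hPQ hQP (Matrix.vecMul v (P * primaryForm f l * Q)) =
        Matrix.vecMul (vecMulEquiv hPQ hQP v) (primaryForm f l) := by
      change Matrix.vecMul (Matrix.vecMul v _) P = Matrix.vecMul (Matrix.vecMul v P) _
      rw [Matrix.vecMul_vecMul, Matrix.vecMul_vecMul, Matrix.mul_assoc _ Q P, hQP, Matrix.mul_one]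
    funext i
    change powerSum (hf.pow _) (fun j => vecMulEquiv hPQ hQP _ ⟨i, j⟩) =
      reduce f (get_partList_le l i) (AdjoinRoot.root (f ^ m)) *
        powerSum (hf.pow _) (fun j => vecMulEquiv hPQ hQP v ⟨i, j⟩)
    rw [h, reduce_root, ← powerSum_vecMul]
    exact congrArg _ (funext fun j => vecMul_blockDiagonal' _ _ _ _)
  · funext i
    exact truncatedSeries_smul (σ i) c fun j => w ⟨i, j⟩
  · funext i
    change truncatedSeries (σ i)
      (fun j => Matrix.vecMul w (nilMatrix (AdjoinRoot f) l) ⟨i, j⟩) =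
      reduce f (get_partList_le l i) (AdjoinRoot.mk (f ^ m) f) * truncatedSeries (σ i) (fun j => w ⟨i, j⟩)
    rw [reduce_mk, ← truncatedSeries_vecMul]
    exact congrArg _ (funext fun j => vecMul_blockDiagonal' _ _ _ _)
  -- Conversely, the class of X is itself a truncated series in f over the lifted field, so x is a
  -- polynomial in y over σ(k').
  · obtain ⟨c, hc⟩ := (truncatedSeries_bijective hf σ₀).2 (AdjoinRoot.root (f ^ m))
    have hc : ∑ j, σ₀ (c j) * AdjoinRoot.mk (f ^ m) f ^ (j : ℕ) = AdjoinRoot.root (f ^ m) := hc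
    set B := Algebra.adjoin k (Set.range (ϖ.comp σ₀) ∪ {ϖ (AdjoinRoot.mk (f ^ m) f)})
    have h1 : ∀ c, ϖ (σ₀ c) ∈ B := fun c => Algebra.subset_adjoin (Or.inl ⟨c, rfl⟩)
    have h2 : ϖ (AdjoinRoot.mk (f ^ m) f) ∈ B := Algebra.subset_adjoin (Or.inr rfl)
    rw [← hc, map_sum]
    refine B.sum_mem fun j _ => ?_
    rw [map_mul, map_pow]
    exact B.mul_mem (h1 _) (B.pow_mem h2 _)

end CommonAlgebra

/-! ### Stability and lattices for all large finite S. -/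

section AlmostAll

open Filter

variable {k k' : Type*} [Field k] [NumberField k] [Field k'] [NumberField k'] [Algebra k k']

lemma algebraMap_mem_integer {S : Set (HeightOneSpectrum (𝓞 k))} {c : k} (hc : c ∈ S.integer k) :
    algebraMap k k' c ∈ (placesAbove k k' S).integer k' := by
  intro w hw
  rw [mem_placesAbove_iff] at hw
  obtain ⟨b, -, hb, y, hy⟩ := exists_mul_eq_algebraMap (k := k) (k' := k) S (x := c)
    (by rwa [placesAbove_self])
  have hy : algebraMap (𝓞 k) k b * c = algebraMap (𝓞 k) k y := hy
  have h1 : algebraMap (𝓞 k') k' (algebraMap (𝓞 k) (𝓞 k') b) * algebraMap k k' c =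
      algebraMap (𝓞 k') k' (algebraMap (𝓞 k) (𝓞 k') y) := by
    have := congrArg (algebraMap k k') hy
    rw [map_mul] at this
    exact this
  have h2 := congrArg (w.valuation k') h1
  rw [map_mul, (HeightOneSpectrum.valuation_eq_one_iff_notMem w).mpr
    (by rw [algebraMap_mem_iff_mem_under]; exact hb _ hw), one_mul] at h2
  rw [h2]
  exact w.valuation_le_one _

variable (k) in
lemma eventually_mem_integer_placesAbove (c : k') :
    ∀ᶠ S : Finset (HeightOneSpectrum (𝓞 k)) in atTop,
      c ∈ (placesAbove k k' (S : Set (HeightOneSpectrum (𝓞 k)))).integer k' := by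
  have hfin := (HeightOneSpectrum.Support.finite (𝓞 k') c).image
    (HeightOneSpectrum.under (𝓞 k))
  filter_upwards [eventually_ge_atTop hfin.toFinset] with S hS w hw
  by_contra hcon
  rw [mem_placesAbove_iff] at hw
  exact hw (hS (hfin.mem_toFinset.mpr ⟨w, not_le.mp hcon, rfl⟩))

lemma eventually_mem_integer (c : k) :
    ∀ᶠ S : Finset (HeightOneSpectrum (𝓞 k)) in atTop,
      c ∈ (S : Set (HeightOneSpectrum (𝓞 k))).integer k := by
  filter_upwards [eventually_mem_integer_placesAbove k c] with S hS
  rwa [placesAbove_self] at hS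

/-- An `S'`-integer is a product of the inverse of an `S`-integer and an integral combination of
an integral basis. -/
lemma exists_eq_sum_basis {S : Set (HeightOneSpectrum (𝓞 k))} {c : k'}
    (hc : c ∈ (placesAbove k k' S).integer k') :
    ∃ a ∈ S.integer k, ∃ z : Module.Free.ChooseBasisIndex ℤ (𝓞 k') → ℤ,
      c = a • ∑ i, z i • algebraMap (𝓞 k') k' (RingOfIntegers.basis k' i) := by
  obtain ⟨b, hb0, hb, y, hy⟩ := exists_mul_eq_algebraMap S hc
  refine ⟨_, inv_mem_integer hb, (RingOfIntegers.basis k').repr y, ?_⟩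
  have h1 : algebraMap (𝓞 k) k b ≠ 0 := by simpa using hb0
  have h2 : ∑ i, (RingOfIntegers.basis k').repr y i •
      algebraMap (𝓞 k') k' (RingOfIntegers.basis k' i) = algebraMap (𝓞 k') k' y := by
    conv_rhs => rw [← (RingOfIntegers.basis k').sum_repr y]
    rw [map_sum]
    exact Finset.sum_congr rfl fun i _ => (map_zsmul _ _ _).symm
  have h3 : algebraMap (𝓞 k') k' (algebraMap (𝓞 k) (𝓞 k') b) =
    algebraMap k k' (algebraMap (𝓞 k) k b) := rfl
  rw [h2, ← hy, Algebra.smul_def, h3, map_inv₀, inv_mul_cancel_left₀]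
  rwa [ne_eq, map_eq_zero]

variable {Z : Type*} [CommRing Z] [Algebra k Z]

/-- If membership of a filtered family of subgroups is eventually stable under scalars and under
generators of an algebra, then it is eventually stable under each element of the algebra. -/
lemma eventually_mul_mem_of_mem_adjoin {I : Type*} {F : Filter I} {G : I → AddSubgroup Z → Prop}
    {s : Set Z} (halg : ∀ c : k, ∀ᶠ S in F, ∀ U, G S U → ∀ u ∈ U, algebraMap k Z c * u ∈ U)
    (hs : ∀ t ∈ s, ∀ᶠ S in F, ∀ U, G S U → ∀ u ∈ U, t * u ∈ U) {z : Z}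
    (hz : z ∈ Algebra.adjoin k s) : ∀ᶠ S in F, ∀ U, G S U → ∀ u ∈ U, z * u ∈ U := by
  induction hz using Algebra.adjoin_induction with
  | mem t ht => exact hs t ht
  | algebraMap c => exact halg c
  | add a b _ _ ha hb =>
    filter_upwards [ha, hb] with S ha hb U hU u hu
    rw [add_mul]
    exact U.add_mem (ha U hU u hu) (hb U hU u hu)
  | mul a b _ _ ha hb =>
    filter_upwards [ha, hb] with S ha hb U hU u hu
    rw [mul_assoc]
    exact ha U hU _ (hb U hU u hu)

/-- Each membership in an adjoined algebra involves finitely many coefficients, integral for large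
S, so stability passes along it uniformly in U. The infinitely many scalars c of 𝔬'_{S'} are reduced
to an integral basis by `exists_eq_sum_basis`. -/
lemma eventually_stable_iff {x y : Z} {σ : k' →ₐ[k] Z} (hy : y ∈ Algebra.adjoin k {x})
    (hσ : ∀ c, σ c ∈ Algebra.adjoin k {x}) (hx : x ∈ Algebra.adjoin k (Set.range σ ∪ {y})) :
    ∀ᶠ S : Finset (HeightOneSpectrum (𝓞 k)) in atTop, ∀ U : AddSubgroup Z,
      ((∀ c ∈ (S : Set (HeightOneSpectrum (𝓞 k))).integer k, ∀ u ∈ U, algebraMap k Z c * u ∈ U) ∧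
        ∀ u ∈ U, x * u ∈ U) ↔
      ((∀ c ∈ (placesAbove k k' (S : Set (HeightOneSpectrum (𝓞 k)))).integer k',
        ∀ u ∈ U, σ c * u ∈ U) ∧ ∀ u ∈ U, y * u ∈ U) := by
  have key : ∀ z ∈ Algebra.adjoin k {x}, ∀ᶠ S : Finset (HeightOneSpectrum (𝓞 k)) in atTop,
      ∀ U : AddSubgroup Z, ((∀ c ∈ (S : Set (HeightOneSpectrum (𝓞 k))).integer k, ∀ u ∈ U,
        algebraMap k Z c * u ∈ U) ∧ ∀ u ∈ U, x * u ∈ U) → ∀ u ∈ U, z * u ∈ U := fun z hz => by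
    refine eventually_mul_mem_of_mem_adjoin (fun c => ?_) (fun t ht => ?_) hz
    · filter_upwards [eventually_mem_integer c] with S hS U hU
      exact hU.1 c hS
    · rw [Set.mem_singleton_iff.mp ht]
      exact Eventually.of_forall fun S U hU => hU.2
  have key' : ∀ᶠ S : Finset (HeightOneSpectrum (𝓞 k)) in atTop, ∀ U : AddSubgroup Z,
      ((∀ c ∈ (placesAbove k k' (S : Set (HeightOneSpectrum (𝓞 k)))).integer k',
        ∀ u ∈ U, σ c * u ∈ U) ∧ ∀ u ∈ U, y * u ∈ U) → ∀ u ∈ U, x * u ∈ U := by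
    refine eventually_mul_mem_of_mem_adjoin (fun c => ?_) (fun t ht => ?_) hx
    · filter_upwards [eventually_mem_integer c] with S hS U hU
      rw [← σ.commutes]
      exact hU.1 _ (algebraMap_mem_integer hS)
    · rcases ht with ⟨c, rfl⟩ | ht
      · filter_upwards [eventually_mem_integer_placesAbove k c] with S hS U hU
        exact hU.1 c hS
      · rw [Set.mem_singleton_iff.mp ht]
        exact Eventually.of_forall fun S U hU => hU.2
  filter_upwards [key y hy, key', eventually_all.mpr fun i =>
    key _ (hσ (algebraMap (𝓞 k') k' (RingOfIntegers.basis k' i)))] with S h1 h2 h3 U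
  refine ⟨fun hU => ⟨fun c hc u hu => ?_, h1 U hU⟩,
    fun hU => ⟨fun c hc u hu => ?_, h2 U hU⟩⟩
  · obtain ⟨a, ha, z, rfl⟩ := exists_eq_sum_basis hc
    rw [map_smul, Algebra.smul_def, mul_assoc]
    refine hU.1 a ha _ ?_
    rw [map_sum, Finset.sum_mul]
    refine U.sum_mem fun i _ => ?_
    rw [map_zsmul, smul_mul_assoc]
    exact U.zsmul_mem (h3 i U hU u hu) _
  · rw [← σ.commutes]
    exact hU.1 _ (algebraMap_mem_integer hc) u hu

/-- It suffices that the finitely many coordinates of the transition maps on generators are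
integral. Since Θ is only k-linear, the generators on the k'-side are multiples of unit vectors by
an integral basis. -/
lemma eventually_lattice_iff {ι κ : Type*} [Fintype ι] [Fintype κ] (Ξ : (ι → k) ≃ₗ[k] Z)
    (Θ : (κ → k') ≃ₗ[k] Z) :
    ∀ᶠ S : Finset (HeightOneSpectrum (𝓞 k)) in atTop, ∀ z : Z,
      (∀ i, Ξ.symm z i ∈ (S : Set (HeightOneSpectrum (𝓞 k))).integer k) ↔
        ∀ j, Θ.symm z j ∈ (placesAbove k k' (S : Set (HeightOneSpectrum (𝓞 k)))).integer k' := by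
  classical
  have h1 : ∀ᶠ S : Finset (HeightOneSpectrum (𝓞 k)) in atTop, ∀ i j,
      Θ.symm (Ξ (Pi.single i 1)) j ∈
        (placesAbove k k' (S : Set (HeightOneSpectrum (𝓞 k)))).integer k' :=
    eventually_all.mpr fun i => eventually_all.mpr fun j =>
      eventually_mem_integer_placesAbove k _
  have h2 : ∀ᶠ S : Finset (HeightOneSpectrum (𝓞 k)) in atTop, ∀ j b i,
      Ξ.symm (Θ (Pi.single j (algebraMap (𝓞 k') k' (RingOfIntegers.basis k' b)))) i ∈
        (S : Set (HeightOneSpectrum (𝓞 k))).integer k :=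
    eventually_all.mpr fun j => eventually_all.mpr fun b => eventually_all.mpr fun i =>
      eventually_mem_integer _
  filter_upwards [h1, h2] with S h1 h2 z
  constructor
  · intro hz j
    obtain ⟨v, rfl⟩ := Ξ.surjective z
    rw [LinearEquiv.symm_apply_apply] at hz
    have hv : v = ∑ i, v i • (Pi.single i 1 : ι → k) := pi_eq_sum_univ' v
    rw [hv]
    simp only [map_sum, map_smul, Finset.sum_apply, Pi.smul_apply]
    refine Subalgebra.sum_mem _ fun i _ => ?_
    rw [Algebra.smul_def]
    exact Subalgebra.mul_mem _ (algebraMap_mem_integer (hz i)) (h1 i j)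
  · intro hz i
    obtain ⟨w, rfl⟩ := Θ.surjective z
    rw [LinearEquiv.symm_apply_apply] at hz
    have hw : w = ∑ j, (Pi.single j (w j) : κ → k') := (Finset.univ_sum_single w).symm
    rw [hw]
    simp only [map_sum, Finset.sum_apply]
    refine Subalgebra.sum_mem _ fun j _ => ?_
    obtain ⟨a, ha, c, hac⟩ := exists_eq_sum_basis (hz j)
    rw [hac]
    have : (Pi.single j (a • ∑ b, c b • algebraMap (𝓞 k') k' (RingOfIntegers.basis k' b)) :
        κ → k') = a • ∑ b, c b •
          (Pi.single j (algebraMap (𝓞 k') k' (RingOfIntegers.basis k' b)) : κ → k') := by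
      change LinearMap.single k (fun _ => k') j _ = _
      rw [map_smul, map_sum]
      simp only [map_zsmul]
      rfl
    rw [this]
    simp only [map_sum, map_smul, map_zsmul, Finset.sum_apply, Pi.smul_apply]
    refine Subalgebra.mul_mem _ ha (Subalgebra.sum_mem _ fun b _ => ?_)
    exact Subalgebra.zsmul_mem _ (h2 j b i) _

end AlmostAll

/-! ### Transfer of invariant submodules along additive isomorphisms. -/

section Transfer

variable {R R' ι κ : Type*} [CommRing R] [CommRing R'] [Fintype ι] [Fintype κ]

/-- The subgroup `U` of `R^ι` is an `A`-invariant `R`-submodule. -/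
def IsStable (A : Matrix ι ι R) (U : AddSubgroup (ι → R)) : Prop :=
  (∀ (r : R), ∀ x ∈ U, r • x ∈ U) ∧ ∀ x ∈ U, Matrix.vecMul x A ∈ U

lemma image_toAddSubgroup_invariantSubmodules (A : Matrix ι ι R) (m : ℕ)
    (p : AddSubgroup (ι → R) → Prop) :
    Submodule.toAddSubgroup '' {U | U ∈ invariantSubmodules A m ∧ p U.toAddSubgroup} =
      {U | IsStable A U ∧ U.index = m ∧ p U} := by
  ext U
  constructor
  · rintro ⟨V, ⟨⟨hV, hm⟩, hp⟩, rfl⟩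
    exact ⟨⟨fun r x hx => V.smul_mem r hx, hV⟩, hm, hp⟩
  · rintro ⟨⟨h1, h2⟩, hm, hp⟩
    exact ⟨{ U with smul_mem' := fun r x hx => h1 r x hx }, ⟨⟨h2, hm⟩, hp⟩, rfl⟩

variable {A : Matrix ι ι R} {B : Matrix κ κ R'}

lemma image_map_stable (ψ : (ι → R) ≃+ (κ → R'))
    (hψ : ∀ U, IsStable A U ↔ IsStable B (U.map ψ.toAddMonoidHom)) (m : ℕ)
    {p : AddSubgroup (ι → R) → Prop} {p' : AddSubgroup (κ → R') → Prop}
    (hp : ∀ U, p U ↔ p' (U.map ψ.toAddMonoidHom)) :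
    AddSubgroup.map ψ.toAddMonoidHom '' {U | IsStable A U ∧ U.index = m ∧ p U} =
      {U | IsStable B U ∧ U.index = m ∧ p' U} := by
  have hidx : ∀ U : AddSubgroup (ι → R), (U.map ψ.toAddMonoidHom).index = U.index :=
    fun U => AddSubgroup.index_map_equiv U ψ
  ext V
  constructor
  · rintro ⟨U, ⟨h1, h2, h3⟩, rfl⟩
    exact ⟨(hψ U).mp h1, (hidx U).trans h2, (hp U).mp h3⟩
  · rintro ⟨h1, h2, h3⟩
    obtain ⟨U, rfl⟩ : ∃ U : AddSubgroup (ι → R), U.map ψ.toAddMonoidHom = V :=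
      ⟨V.comap ψ.toAddMonoidHom, AddSubgroup.map_comap_eq_self_of_surjective ψ.surjective V⟩
    exact ⟨U, ⟨(hψ U).mpr h1, (hidx U).symm.trans h2, (hp U).mpr h3⟩, rfl⟩

/-- The two base rings differ, so submodules are compared through their additive groups. The
predicates p and p' are trivial for the global count and express primarity for the local one. -/
lemma ncard_invariantSubmodules_eq (ψ : (ι → R) ≃+ (κ → R'))
    (hψ : ∀ U, IsStable A U ↔ IsStable B (U.map ψ.toAddMonoidHom)) (m : ℕ)
    {p : AddSubgroup (ι → R) → Prop} {p' : AddSubgroup (κ → R') → Prop}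
    (hp : ∀ U, p U ↔ p' (U.map ψ.toAddMonoidHom)) :
    {U | U ∈ invariantSubmodules A m ∧ p U.toAddSubgroup}.ncard =
      {U | U ∈ invariantSubmodules B m ∧ p' U.toAddSubgroup}.ncard := by
  rw [← Set.ncard_image_of_injective _ Submodule.toAddSubgroup_injective,
    ← Set.ncard_image_of_injective {U | U ∈ invariantSubmodules B m ∧ p' U.toAddSubgroup}
      Submodule.toAddSubgroup_injective,
    image_toAddSubgroup_invariantSubmodules, image_toAddSubgroup_invariantSubmodules,
    ← image_map_stable ψ hψ m hp,
    Set.ncard_image_of_injective _ (AddSubgroup.map_injective ψ.injective)]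

lemma coeffs_eq_of_equiv (ψ : (ι → R) ≃+ (κ → R'))
    (hψ : ∀ U, IsStable A U ↔ IsStable B (U.map ψ.toAddMonoidHom)) : coeffs A = coeffs B := by
  ext m
  rcases eq_or_ne m 0 with rfl | hm
  · simp
  rw [coeffs_apply _ hm, coeffs_apply _ hm]
  simpa using ncard_invariantSubmodules_eq ψ hψ m (p := fun _ => True) (p' := fun _ => True)
    (fun _ => Iff.rfl)

lemma hasZeta_of_equiv (ψ : (ι → R) ≃+ (κ → R'))
    (hψ : ∀ U, IsStable A U ↔ IsStable B (U.map ψ.toAddMonoidHom)) (hB : HasZeta B) :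
    HasZeta A := by
  refine ⟨fun m hm => ?_, ?_⟩
  · have h := (hB.1 m hm).image Submodule.toAddSubgroup
    have h1 := image_toAddSubgroup_invariantSubmodules A m fun _ => True
    have h2 := image_toAddSubgroup_invariantSubmodules B m fun _ => True
    simp only [and_true, Set.ofPred_mem_eq] at h1 h2
    have h3 := image_map_stable ψ hψ m (p := fun _ => True) (p' := fun _ => True)
      (fun _ => Iff.rfl)
    simp only [and_true] at h3
    rw [h2, ← h3, ← h1] at h
    exact Set.Finite.of_finite_image
      (Set.Finite.of_finite_image h (AddSubgroup.map_injective ψ.injective).injOn)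
      Submodule.toAddSubgroup_injective.injOn
  · have h := hB.2
    rwa [abscissa, ← coeffs_eq_of_equiv ψ hψ] at h

end Transfer

/-! ### Primary submodules under extension of the number field. -/

section PrimaryTransfer

variable {k k' : Type*} [Field k] [NumberField k] [Field k'] [NumberField k'] [Algebra k k']
variable {R R' ι κ : Type*} [CommRing R] [CommRing R'] [Fintype ι] [Fintype κ]
  [Algebra (𝓞 k) R] [Algebra (𝓞 k') R']

lemma map_pow_mem_supportedIdeals (v : HeightOneSpectrum (𝓞 k)) (N : ℕ) :
    (v.asIdeal ^ N).map (algebraMap (𝓞 k) (𝓞 k')) ∈ supportedIdeals (placesAbove k k' {v}) := by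
  rw [Ideal.map_pow]
  refine pow_mem (mem_supportedIdeals (Ideal.map_ne_bot_of_ne_bot v.ne_bot) fun p hp => ?_) N
  rw [mem_placesAbove_iff]
  have h : v.asIdeal ≤ (p.under (𝓞 k)).asIdeal := Ideal.map_le_iff_le_comap.mp hp
  exact (HeightOneSpectrum.ext (v.isMaximal.eq_of_le (p.under (𝓞 k)).isPrime.ne_top h)).symm

/-- Every w above v contains the extension of v, and exponents add in products. So extended powers
of v are cofinal among the ideals supported above v, which makes the two notions of primarity agree.
-/
lemma exists_map_pow_le {v : HeightOneSpectrum (𝓞 k)} {J : Ideal (𝓞 k')}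
    (hJ : J ∈ supportedIdeals (placesAbove k k' {v})) :
    ∃ N : ℕ, (v.asIdeal ^ N).map (algebraMap (𝓞 k) (𝓞 k')) ≤ J := by
  induction hJ using Submonoid.closure_induction with
  | mem x hx =>
    obtain ⟨w, hw, rfl⟩ := hx
    rw [mem_placesAbove_iff, Set.mem_singleton_iff] at hw
    exact ⟨1, by rw [pow_one, ← hw]; exact Ideal.map_comap_le⟩
  | one => exact ⟨0, by rw [Ideal.one_eq_top]; exact le_top⟩
  | mul x y _ _ hx hy =>
    obtain ⟨a, ha⟩ := hx
    obtain ⟨b, hb⟩ := hy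
    exact ⟨a + b, by rw [pow_add, Ideal.map_mul]; exact Ideal.mul_mono ha hb⟩

lemma exists_supportedIdeals_iff (ψ : (ι → R) ≃+ (κ → R'))
    (hψ : ∀ (a : 𝓞 k) x, ψ (a • x) = algebraMap (𝓞 k) (𝓞 k') a • ψ x)
    (v : HeightOneSpectrum (𝓞 k)) (U : AddSubgroup (ι → R)) :
    (∃ J ∈ supportedIdeals {v}, ∀ a ∈ J, ∀ x : ι → R, a • x ∈ U) ↔
      ∃ J ∈ supportedIdeals (placesAbove k k' {v}), ∀ a ∈ J, ∀ x : κ → R',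
        a • x ∈ U.map ψ.toAddMonoidHom := by
  constructor
  · rintro ⟨J, hJ, hJU⟩
    obtain ⟨N, rfl⟩ := mem_supportedIdeals_singleton.mp hJ
    refine ⟨_, map_pow_mem_supportedIdeals v N, fun a ha => ?_⟩
    induction ha using Submodule.span_induction with
    | mem a ha =>
      obtain ⟨b, hb, rfl⟩ := ha
      intro x
      obtain ⟨y, rfl⟩ := ψ.surjective x
      exact ⟨b • y, hJU b hb y, hψ b y⟩
    | zero => exact fun x => by rw [zero_smul]; exact AddSubgroup.zero_mem _
    | add a b _ _ ha hb =>
      exact fun x => by rw [add_smul]; exact AddSubgroup.add_mem _ (ha x) (hb x)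
    | smul c a _ ha => exact fun x => by rw [smul_eq_mul, mul_comm, mul_smul]; exact ha _
  · rintro ⟨J, hJ, hJU⟩
    obtain ⟨N, hN⟩ := exists_map_pow_le hJ
    refine ⟨_, mem_supportedIdeals_singleton.mpr ⟨N, rfl⟩, fun a ha x => ?_⟩
    obtain ⟨y, hy, hyx⟩ := hJU _ (hN (Ideal.mem_map_of_mem _ ha)) (ψ x)
    rw [← hψ] at hyx
    rwa [← ψ.injective hyx]

lemma primaryCoeffs_eq_of_equiv {A : Matrix ι ι R} {B : Matrix κ κ R'}
    (ψ : (ι → R) ≃+ (κ → R')) (hψ : ∀ U, IsStable A U ↔ IsStable B (U.map ψ.toAddMonoidHom))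
    (hψ' : ∀ (a : 𝓞 k) x, ψ (a • x) = algebraMap (𝓞 k) (𝓞 k') a • ψ x)
    (v : HeightOneSpectrum (𝓞 k)) :
    primaryCoeffs {v} A = primaryCoeffs (placesAbove k k' {v}) B := by
  ext m
  rcases eq_or_ne m 0 with rfl | hm
  · simp
  rw [primaryCoeffs_apply _ _ hm, primaryCoeffs_apply _ _ hm]
  exact ncard_invariantSubmodules_eq ψ hψ m
    (p := fun U => ∃ J ∈ supportedIdeals {v}, ∀ a ∈ J, ∀ x : ι → R, a • x ∈ U)
    (p' := fun U => ∃ J ∈ supportedIdeals (placesAbove k k' {v}), ∀ a ∈ J, ∀ x : κ → R', a • x ∈ U)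
    (exists_supportedIdeals_iff ψ hψ' v)

end PrimaryTransfer

/-! ### Dirichlet series: finite products and domination. -/

section LSeries

lemma lSeries_prod {W : Type*} (T : Finset W) (g : W → ArithmeticFunction ℕ) (s : ℂ)
    (hg : ∀ w ∈ T, LSeriesSummable (fun m => (g w m : ℂ)) s) :
    LSeriesSummable (fun m => ((∏ w ∈ T, g w) m : ℂ)) s ∧
      LSeries (fun m => ((∏ w ∈ T, g w) m : ℂ)) s =
        ∏ w ∈ T, LSeries (fun m => (g w m : ℂ)) s := by
  classical
  induction T using Finset.induction_on with
  | empty =>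
    have h : (fun m => (((1 : ArithmeticFunction ℕ) m : ℕ) : ℂ)) = LSeries.delta := by
      ext m
      simp [ArithmeticFunction.one_apply, LSeries.delta]
    rw [Finset.prod_empty, Finset.prod_empty, h]
    refine ⟨?_, congrFun LSeries_delta s⟩
    rw [LSeriesSummable, funext (LSeries.term_delta s)]
    exact (hasSum_ite_eq 1 1).summable
  | insert w T hw ih =>
    obtain ⟨h1, h2⟩ := ih fun w hw => hg w (Finset.mem_insert_of_mem hw)
    have h3 := hg w (Finset.mem_insert_self w T)
    have h : (fun m => (((g w * ∏ w ∈ T, g w) m : ℕ) : ℂ)) =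
        fun m => (((g w : ArithmeticFunction ℂ) * ((∏ w ∈ T, g w : ArithmeticFunction ℕ) :
          ArithmeticFunction ℂ)) m : ℂ) := by
      ext m
      rw [← ArithmeticFunction.natCoe_mul, ArithmeticFunction.natCoe_apply]
    rw [Finset.prod_insert hw, Finset.prod_insert hw, h, ← h2]
    exact ⟨ArithmeticFunction.LSeriesSummable_mul h3 h1, ArithmeticFunction.LSeries_mul' h3 h1⟩

lemma abscissa_le_of_coeffs_le {R R' ι κ : Type*} [CommRing R] [CommRing R'] [Fintype ι]
    [Fintype κ] {A : Matrix ι ι R} {B : Matrix κ κ R'} (h : ∀ m, coeffs A m ≤ coeffs B m) :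
    abscissa A ≤ abscissa B := by
  refine LSeries.abscissaOfAbsConv_le_of_forall_lt_LSeriesSummable' fun y hy => ?_
  have hB : LSeriesSummable (fun m => (coeffs B m : ℂ)) y :=
    LSeriesSummable_of_abscissaOfAbsConv_lt_re hy
  refine Summable.of_norm_bounded hB.norm fun m => ?_
  refine LSeries.norm_term_le _ ?_
  simpa using h m

end LSeries

/-! ### Comparison of the two lattices inside Z. -/

section Comparison

open Filter

variable {k k' Z : Type*} [Field k] [NumberField k] [Field k'] [NumberField k'] [Algebra k k']
  [CommRing Z] [Algebra k Z]

lemma forall_mem_iff_forall_mem_map {M Z : Type*} [AddCommGroup M] [CommRing Z] {j : M →+ Z}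
    (hj : Function.Injective j) {op : M → M} {z : Z} (h : ∀ v, j (op v) = z * j v)
    (U : AddSubgroup M) : (∀ v ∈ U, op v ∈ U) ↔ ∀ u ∈ U.map j, z * u ∈ U.map j := by
  constructor
  · rintro hU _ ⟨v, hv, rfl⟩
    exact ⟨op v, hU v hv, h v⟩
  · intro hU v hv
    obtain ⟨v', hv', h'⟩ := hU _ ⟨v, hv, rfl⟩
    rw [← h] at h'
    rwa [← hj h']

/-- The inclusion of the lattice `R^ι` into `Z` given by a linear map on the ambient space. -/
def latticeHom {D K ι : Type*} [CommRing D] [Field K] [Algebra D K] (R : Subalgebra D K)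
    (Ξ : (ι → K) →+ Z) : (ι → R) →+ Z :=
  Ξ.comp (AddMonoidHom.mk' (fun v i => (v i : K)) fun _ _ => rfl)

lemma latticeHom_apply {D K ι : Type*} [CommRing D] [Field K] [Algebra D K] (R : Subalgebra D K)
    (Ξ : (ι → K) →+ Z) (v : ι → R) : latticeHom R Ξ v = Ξ fun i => (v i : K) := rfl

/-- Inside Z, scalars and matrix alike become multiplications. The map τ is `algebraMap k Z` on one
side and σ on the other. -/
lemma isStable_iff {D K ι : Type*} [Fintype ι] [CommRing D] [Field K] [Algebra D K]
    (R : Subalgebra D K) {Ξ : (ι → K) →+ Z} (hΞ : Function.Injective Ξ) {A : Matrix ι ι R}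
    {x : Z} {τ : K → Z} (hx : ∀ v, Ξ (Matrix.vecMul v (A.map fun a => (a : K))) = x * Ξ v)
    (hτ : ∀ c v, Ξ (c • v) = τ c * Ξ v) (U : AddSubgroup (ι → R)) :
    IsStable A U ↔ (∀ c ∈ R, ∀ u ∈ U.map (latticeHom R Ξ), τ c * u ∈ U.map (latticeHom R Ξ)) ∧
      ∀ u ∈ U.map (latticeHom R Ξ), x * u ∈ U.map (latticeHom R Ξ) := by
  have hinj : Function.Injective (latticeHom R Ξ) := fun v v' h =>
    funext fun i => Subtype.ext (congrFun (hΞ h) i)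
  refine and_congr ?_ ?_
  · rw [Subtype.forall]
    refine forall₂_congr fun c hc => forall_mem_iff_forall_mem_map hinj (fun v => ?_) U
    exact hτ c fun i => (v i : K)
  · refine forall_mem_iff_forall_mem_map hinj (fun v => ?_) U
    rw [latticeHom_apply, latticeHom_apply, ← hx]
    congr 1
    ext i
    exact RingHom.map_vecMul R.val.toRingHom A v i

/-- The isomorphism is Θ⁻¹ ∘ Ξ restricted to the lattices, which it matches for large S.
Corresponding subgroups have the same image in Z, so `eventually_stable_iff` compares their
stability there. -/
lemma eventually_exists_equiv {ι κ : Type*} [Fintype ι] [Fintype κ] {A : Matrix ι ι k}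
    {N : Matrix κ κ k'} {x y : Z} {σ : k' →ₐ[k] Z} (Ξ : (ι → k) ≃ₗ[k] Z) (Θ : (κ → k') ≃ₗ[k] Z)
    (hA : ∀ v, Ξ (Matrix.vecMul v A) = x * Ξ v) (hΘ : ∀ c w, Θ (c • w) = σ c * Θ w)
    (hN : ∀ w, Θ (Matrix.vecMul w N) = y * Θ w) (hy : y ∈ Algebra.adjoin k {x})
    (hσ : ∀ c, σ c ∈ Algebra.adjoin k {x}) (hx : x ∈ Algebra.adjoin k (Set.range σ ∪ {y})) :
    ∀ᶠ S : Finset (HeightOneSpectrum (𝓞 k)) in atTop,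
      ∀ (AS : Matrix ι ι ((S : Set (HeightOneSpectrum (𝓞 k))).integer k))
        (NS : Matrix κ κ ((placesAbove k k' (S : Set (HeightOneSpectrum (𝓞 k)))).integer k')),
      AS.map (fun a => (a : k)) = A → NS.map (fun a => (a : k')) = N →
      ∃ ψ : (ι → (S : Set (HeightOneSpectrum (𝓞 k))).integer k) ≃+
          (κ → (placesAbove k k' (S : Set (HeightOneSpectrum (𝓞 k)))).integer k'),
        (∀ U, IsStable AS U ↔ IsStable NS (U.map ψ.toAddMonoidHom)) ∧
        ∀ (a : 𝓞 k) v, ψ (a • v) = algebraMap (𝓞 k) (𝓞 k') a • ψ v := by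
  filter_upwards [eventually_stable_iff hy hσ hx, eventually_lattice_iff Ξ Θ] with
    S hstab hlat AS NS hAS hNS
  let ψ : (ι → (S : Set (HeightOneSpectrum (𝓞 k))).integer k) ≃+
      (κ → (placesAbove k k' (S : Set (HeightOneSpectrum (𝓞 k)))).integer k') :=
    { toFun := fun v j => ⟨Θ.symm (Ξ fun i => (v i : k)) j,
        (hlat _).mp (fun i => by rw [LinearEquiv.symm_apply_apply]; exact (v i).2) j⟩
      invFun := fun w i => ⟨Ξ.symm (Θ fun j => (w j : k')) i,
        (hlat _).mpr (fun j => by rw [LinearEquiv.symm_apply_apply]; exact (w j).2) i⟩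
      left_inv := fun v => by simp
      right_inv := fun w => by simp
      map_add' := fun v v' => by
        ext j
        have : (fun i => ((v + v') i : k)) = (fun i => (v i : k)) + fun i => (v' i : k) := rfl
        simp only [this, map_add]
        rfl }
  have hψ : ∀ v, Θ (fun j => (ψ v j : k')) = Ξ fun i => (v i : k) := fun v =>
    Θ.apply_symm_apply _
  have hmap : ∀ U : AddSubgroup (ι → (S : Set (HeightOneSpectrum (𝓞 k))).integer k),
      (U.map ψ.toAddMonoidHom).map (latticeHom _ (Θ : (κ → k') →+ Z)) =
        U.map (latticeHom _ (Ξ : (ι → k) →+ Z)) := fun U => by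
    rw [AddSubgroup.map_map]
    congr 1
    ext v
    exact hψ v
  refine ⟨ψ, fun U => ?_, fun a v => ?_⟩
  · rw [isStable_iff _ (Ξ := (Ξ : (ι → k) →+ Z)) Ξ.injective (τ := algebraMap k Z) (x := x)
        (by rw [hAS]; exact hA) (fun c v => by rw [← Algebra.smul_def]; exact map_smul Ξ c v),
      isStable_iff _ (Ξ := (Θ : (κ → k') →+ Z)) Θ.injective (τ := σ) (x := y)
        (by rw [hNS]; exact hN) hΘ, hmap]
    exact hstab _
  · have h1 : (fun j => (ψ (a • v) j : k')) =
        fun j => algebraMap k k' (algebraMap (𝓞 k) k a) * (ψ v j : k') := by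
      apply Θ.injective
      rw [hψ]
      have : (fun j => algebraMap k k' (algebraMap (𝓞 k) k a) * (ψ v j : k')) =
        algebraMap (𝓞 k) k a • fun j => (ψ v j : k') := by
          ext j
          rw [Pi.smul_apply, Algebra.smul_def]
      rw [this, map_smul, hψ, ← map_smul]
      rfl
    ext j
    exact congrFun h1 j

lemma nilMatrix_map {R R' : Type*} [CommRing R] [CommRing R'] (φ : R →+* R') {m : ℕ}
    (l : m.Partition) : (nilMatrix R l).map φ = nilMatrix R' l := by
  rw [nilMatrix, nilMatrix, Matrix.blockDiagonal'_map _ _ (map_zero φ)]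
  congr 1
  ext i a b
  simp only [companion, Matrix.map_apply, Matrix.of_apply, coeff_X_pow]
  split_ifs <;> simp

end Comparison

/-! ### The local Euler product. -/

section EulerProduct

variable {k k' : Type*} [Field k] [NumberField k] [Field k'] [NumberField k'] [Algebra k k']

lemma finite_liesOver (v : HeightOneSpectrum (𝓞 k)) :
    {w : HeightOneSpectrum (𝓞 k') | w.asIdeal.LiesOver v.asIdeal}.Finite := by
  refine (Ideal.finite_factors (I := v.asIdeal.map (algebraMap (𝓞 k) (𝓞 k')))
    (Ideal.map_ne_bot_of_ne_bot v.ne_bot)).subset fun w hw => ?_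
  have hw : w.asIdeal.LiesOver v.asIdeal := hw
  exact Ideal.dvd_iff_le.mpr (Ideal.map_le_iff_le_comap.mpr hw.over.le)

lemma placesAbove_singleton (v : HeightOneSpectrum (𝓞 k)) :
    placesAbove k k' {v} = {w | w.asIdeal.LiesOver v.asIdeal} := by
  ext w
  simp [placesAbove]

/-- If the matrices `A` over the `S`-integers of `k` and `N(λ)` over the `S'`-integers of `k'`
have the same invariant submodules, then the zeta function of `A` at a place outside `S` is the
product of the zeta functions of `N(λ)` at the places above. -/
lemma local_euler_product {ι : Type*} [Fintype ι] {S : Set (HeightOneSpectrum (𝓞 k))}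
    {v : HeightOneSpectrum (𝓞 k)} (hv : v ∉ S) (AS : Matrix ι ι (S.integer k)) {m : ℕ}
    (l : m.Partition)
    (h : primaryCoeffs {v} AS =
      primaryCoeffs (placesAbove k k' {v}) (nilMatrix ((placesAbove k k' S).integer k') l)) :
    coeffs (AS.map (integerToCompletion hv)) =
      ∏ᶠ (w : HeightOneSpectrum (𝓞 k')) (_ : w.asIdeal.LiesOver v.asIdeal),
        coeffs (nilMatrix (w.adicCompletionIntegers k') l) ∧
    ∀ s : ℂ, abscissa (AS.map (integerToCompletion hv)) < (s.re : EReal) →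
      (∀ w : HeightOneSpectrum (𝓞 k'), w.asIdeal.LiesOver v.asIdeal →
        abscissa (nilMatrix (w.adicCompletionIntegers k') l) < (s.re : EReal)) ∧
      zeta (AS.map (integerToCompletion hv)) s =
        ∏ᶠ (w : HeightOneSpectrum (𝓞 k')) (_ : w.asIdeal.LiesOver v.asIdeal),
          zeta (nilMatrix (w.adicCompletionIntegers k') l) s := by
  set N := nilMatrix ((placesAbove k k' S).integer k') l
  have hN : ∀ m ≠ 0, (invariantSubmodules N m).Finite := (hasZeta_integer S N).1
  have hfin := finite_liesOver (k' := k') v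
  have hA : coeffs (AS.map (integerToCompletion hv)) =
      primaryCoeffs {w : HeightOneSpectrum (𝓞 k') | w.asIdeal.LiesOver v.asIdeal} N := by
    rw [coeffs_map_integerToCompletion, h, placesAbove_singleton]
  have hw : ∀ w : HeightOneSpectrum (𝓞 k'), w.asIdeal.LiesOver v.asIdeal →
      coeffs (nilMatrix (w.adicCompletionIntegers k') l) = primaryCoeffs {w} N := fun w hwv => by
    have hwS : w ∉ placesAbove k k' S := by
      rintro ⟨v', hv', hw'⟩
      have : v' = v := HeightOneSpectrum.ext (hw'.over.trans hwv.over.symm)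
      exact hv (this ▸ hv')
    rw [← nilMatrix_map (integerToCompletion hwS) l, coeffs_map_integerToCompletion]
  have hprod : coeffs (AS.map (integerToCompletion hv)) =
      ∏ w ∈ hfin.toFinset, coeffs (nilMatrix (w.adicCompletionIntegers k') l) := by
    have hT := primaryCoeffs_eq_prod hN hfin.toFinset
    rw [hfin.coe_toFinset] at hT
    rw [hA, hT]
    exact Finset.prod_congr rfl fun w hwv => (hw w (by simpa using hwv)).symm
  -- A w-primary submodule is also primary for the set of all places above v, so the coefficients of
  -- each factor are at most those of the product. Hence convergence on the left forces convergence
  -- of every factor.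
  have hle : ∀ w : HeightOneSpectrum (𝓞 k'), w.asIdeal.LiesOver v.asIdeal →
      abscissa (nilMatrix (w.adicCompletionIntegers k') l) ≤
        abscissa (AS.map (integerToCompletion hv)) := fun w hwv =>
    abscissa_le_of_coeffs_le fun m => by
      rw [hw w hwv, hA]
      exact primaryCoeffs_mono (Set.singleton_subset_iff.mpr hwv) hN m
  refine ⟨hprod.trans (finprod_mem_eq_finite_toFinset_prod _ hfin).symm, fun s hs =>
    ⟨fun w hwv => (hle w hwv).trans_lt hs, ?_⟩⟩
  rw [zeta, hprod, (lSeries_prod _ _ s fun w hwv => ?_).2]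
  · exact (finprod_mem_eq_finite_toFinset_prod _ hfin).symm
  · exact LSeriesSummable_of_abscissaOfAbsConv_lt_re
      ((hle w (by simpa using hwv)).trans_lt hs)

end EulerProduct

/-! ### The finite exceptional set. -/

section AlmostAllPlaces

open Filter

variable {k k' : Type*} [Field k] [NumberField k] [Field k'] [NumberField k'] [Algebra k k']

lemma exists_finite_forall_transfer {Z : Type*} [CommRing Z] [Algebra k Z] {n m : ℕ}
    {A : Matrix (Fin n) (Fin n) k} (l : m.Partition) {x y : Z} {σ : k' →ₐ[k] Z}
    (Ξ : (Fin n → k) ≃ₗ[k] Z)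
    (Θ : ((Σ i : Fin (partList l).length, Fin ((partList l).get i)) → k') ≃ₗ[k] Z)
    (hA : ∀ v, Ξ (Matrix.vecMul v A) = x * Ξ v) (hΘ : ∀ c w, Θ (c • w) = σ c * Θ w)
    (hN : ∀ w, Θ (Matrix.vecMul w (nilMatrix k' l)) = y * Θ w) (hy : y ∈ Algebra.adjoin k {x})
    (hσ : ∀ c, σ c ∈ Algebra.adjoin k {x}) (hx : x ∈ Algebra.adjoin k (Set.range σ ∪ {y})) :
    ∃ S₀ : Set (HeightOneSpectrum (𝓞 k)), S₀.Finite ∧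
      ∀ S : Set (HeightOneSpectrum (𝓞 k)), S.Finite → S₀ ⊆ S →
        ∃ AS : Matrix (Fin n) (Fin n) (S.integer k), AS.map (fun x => (x : k)) = A ∧
          HasZeta AS ∧ coeffs AS = coeffs (nilMatrix ((placesAbove k k' S).integer k') l) ∧
          ∀ v, primaryCoeffs {v} AS = primaryCoeffs (placesAbove k k' {v})
            (nilMatrix ((placesAbove k k' S).integer k') l) := by
  have hint : ∀ᶠ S : Finset (HeightOneSpectrum (𝓞 k)) in atTop, ∀ i j,
      A i j ∈ (S : Set (HeightOneSpectrum (𝓞 k))).integer k :=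
    eventually_all.mpr fun i => eventually_all.mpr fun j => eventually_mem_integer _
  obtain ⟨S₀, hS₀⟩ := eventually_atTop.mp
    (hint.and (eventually_exists_equiv Ξ Θ hA hΘ hN hy hσ hx))
  refine ⟨S₀, S₀.finite_toSet, fun S hS hS₀S => ?_⟩
  obtain ⟨S, rfl⟩ := hS.exists_finset_coe
  obtain ⟨h1, h2⟩ := hS₀ S (by simpa using hS₀S)
  obtain ⟨ψ, hψ, hψ'⟩ := h2 (Matrix.of fun i j => ⟨A i j, h1 i j⟩)
    (nilMatrix ((placesAbove k k' (S : Set (HeightOneSpectrum (𝓞 k)))).integer k') l) rfl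
    (nilMatrix_map (Subalgebra.val ((placesAbove k k'
      (S : Set (HeightOneSpectrum (𝓞 k)))).integer k')).toRingHom l)
  exact ⟨_, rfl, hasZeta_of_equiv ψ hψ (hasZeta_integer _ _), coeffs_eq_of_equiv ψ hψ,
    primaryCoeffs_eq_of_equiv ψ hψ hψ'⟩

end AlmostAllPlaces

end InvariantZeta

end

theorem theorem3p1 {k : Type*} [Field k] [NumberField k]
    (f : k[X]) (hmonic : f.Monic) [Fact (Irreducible f)]
    {n : ℕ} (hn : 0 < n) (A : Matrix (Fin n) (Fin n) k)
    {m : ℕ} (l : m.Partition) (hA : InvariantZeta.IsPrimaryOfType f A l) :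
    -- the local statement, for almost all places `v` of `k`
    (∀ᶠ v : HeightOneSpectrum (𝓞 k) in Filter.cofinite,
      ∃ Av : Matrix (Fin n) (Fin n) (v.adicCompletionIntegers k),
        Av.map (fun x => (x : v.adicCompletion k)) =
          A.map (algebraMap k (v.adicCompletion k)) ∧
        InvariantZeta.HasZeta Av ∧
        (∀ w : HeightOneSpectrum (𝓞 (AdjoinRoot f)), w.asIdeal.LiesOver v.asIdeal →
          InvariantZeta.HasZeta
            (InvariantZeta.nilMatrix (w.adicCompletionIntegers (AdjoinRoot f)) l)) ∧
        -- equality as Dirichlet series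
        InvariantZeta.coeffs Av =
          ∏ᶠ (w : HeightOneSpectrum (𝓞 (AdjoinRoot f))) (_ : w.asIdeal.LiesOver v.asIdeal),
            InvariantZeta.coeffs
              (InvariantZeta.nilMatrix (w.adicCompletionIntegers (AdjoinRoot f)) l) ∧
        -- equality as functions on the half-plane of convergence
        ∀ s : ℂ, InvariantZeta.abscissa Av < (s.re : EReal) →
          (∀ w : HeightOneSpectrum (𝓞 (AdjoinRoot f)), w.asIdeal.LiesOver v.asIdeal →
            InvariantZeta.abscissa
              (InvariantZeta.nilMatrix (w.adicCompletionIntegers (AdjoinRoot f)) l) <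
                (s.re : EReal)) ∧
          InvariantZeta.zeta Av s =
            ∏ᶠ (w : HeightOneSpectrum (𝓞 (AdjoinRoot f))) (_ : w.asIdeal.LiesOver v.asIdeal),
              InvariantZeta.zeta
                (InvariantZeta.nilMatrix (w.adicCompletionIntegers (AdjoinRoot f)) l) s) ∧
    -- the global statement, for all sufficiently large finite sets `S` of places of `k`
    (∃ S₀ : Set (HeightOneSpectrum (𝓞 k)), S₀.Finite ∧
      ∀ S : Set (HeightOneSpectrum (𝓞 k)), S.Finite → S₀ ⊆ S →
        ∃ AS : Matrix (Fin n) (Fin n) (S.integer k),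
          AS.map (fun x => (x : k)) = A ∧
          InvariantZeta.HasZeta AS ∧
          InvariantZeta.HasZeta (InvariantZeta.nilMatrix
            ((InvariantZeta.placesAbove k (AdjoinRoot f) S).integer (AdjoinRoot f)) l) ∧
          -- equality as Dirichlet series
          InvariantZeta.coeffs AS = InvariantZeta.coeffs (InvariantZeta.nilMatrix
            ((InvariantZeta.placesAbove k (AdjoinRoot f) S).integer (AdjoinRoot f)) l) ∧
          -- equality as functions on the half-plane of convergence
          ∀ s : ℂ, InvariantZeta.abscissa AS < (s.re : EReal) →
            InvariantZeta.zeta AS s = InvariantZeta.zeta (InvariantZeta.nilMatrix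
              ((InvariantZeta.placesAbove k (AdjoinRoot f) S).integer (AdjoinRoot f)) l) s) := by
  obtain ⟨x, y, σ, Ξ, Θ, hA, hΘ, hN, hy, hσ, hx⟩ :=
    InvariantZeta.exists_common_algebra hmonic A l hA.2
  obtain ⟨S₀, hfin, hS₀⟩ :=
    InvariantZeta.exists_finite_forall_transfer l Ξ Θ hA hΘ hN hy hσ hx
  refine ⟨?_, S₀, hfin, fun S hS hS₀S => ?_⟩
  -- The single choice S = S₀ serves all places v outside S₀.
  · obtain ⟨AS, hAS, -, -, hprim⟩ := hS₀ S₀ hfin subset_rfl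
    filter_upwards [hfin.compl_mem_cofinite] with v hv
    obtain ⟨h1, h2⟩ := InvariantZeta.local_euler_product hv AS l (hprim v)
    refine ⟨AS.map (InvariantZeta.integerToCompletion hv), ?_,
      InvariantZeta.hasZeta_completion v _, fun w _ => InvariantZeta.hasZeta_completion w _,
      h1, h2⟩
    rw [← hAS]
    rfl
  · obtain ⟨AS, hAS, hzeta, hcoeffs, -⟩ := hS₀ S hS hS₀S
    refine ⟨AS, hAS, hzeta, InvariantZeta.hasZeta_integer _ _, hcoeffs, fun s _ => ?_⟩
    rw [InvariantZeta.zeta, InvariantZeta.zeta, hcoeffs]
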